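/- There are absolute constants $C, c > 0$ such that the following holds. Let $m,n$ be positive integers and let $A=(a_{ij}) \in \mathbb{R}^{m\times n}$ be a random matrix whose entries are (mutually) independent, have finite fourth moments, and all have the same variance, which is positive. For a positive integer $k$ put $$\mu_k(A) := \max_{i,j}\bigl|\mathbb{E}\{(a_{ij}-\mathbb{E}a_{ij})^k\}\bigr|, \qquad K(A) := \mu_2(A)^2+\mu_3(A)+\mu_2(A)\mu_3(A)+\mu_4(A).$$ Suppose that, for some $\kappa>0$ and $\alpha\ge 1/2$, every entry of $A-\mathbb{E}\{A\}$ satisfies $$\|a_{ij}-\mathbb{E}a_{ij}\|_p := \bigl(\mathbb{E}|a_{ij}-\mathbb{E}a_{ij}|^p\bigr)^{1/p} \le \kappa p^\alpha \quad\text{for all real } p \text{ with } 1\le p\le \log(en).$$ Let $\rho\in(0,1)$, $\tau>0$, $s\in\{1,\dots,n\}$, and suppose that $$m \ge \max\left\{ C\left(\frac{K(A)}{\mu_2(A)^{5/2}\,\tau}\Bigl(1+\tau\rho^{-1}\bigl(e^{2\alpha}\kappa\sqrt{s\log(en/s)}+F(A)\bigr)\Bigr)\right)^2,\ (\log(en))^{\max\{2\alpha-1,1\}}\right\},$$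 where $F(A):=\min\{\|\mathbb{E}\{A\}\|_{\mathsf F,s},\ \sqrt{s\log n}\,\|\mathbb{E}\{A\}\|_\infty\}$; here, for a matrix $M=(m_{ij})\in\mathbb{R}^{m\times n}$, $\|M\|_\infty:=\max_{i,j}|m_{ij}|$ and $\|M\|_{\mathsf F,s}:=\max_{S\subseteq[n],\,|S|=s}\bigl(\sum_{j\in S}\sum_{i=1}^m m_{ij}^2\bigr)^{1/2}$. Then, with probability at least $$1-\exp\left(-c\,\frac{\mu_2(A)^4}{K(A)^2}\,m\right),$$ the matrix $A$ satisfies $\ell_2$-$\mathrm{RNSP}(s,\rho,\tau)$, that is, $$\|v_S\|_2\le\frac{\rho}{\sqrt s}\,\|v_{[n]\setminus S}\|_1+\tau\|Av\|_2 \quad\text{for every } v\in\mathbb{R}^n \text{ and every } S\subseteq[n] \text{ with } |S|\le s,$$ where $v_S$ agrees with $v$ on $S$ and vanishes off $S$. -/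

import Mathlib

open MeasureTheory ProbabilityTheory

noncomputable section

namespace RobustNSP

/-- `M` satisfies `ℓ₂-RNSP(s, ρ, τ)`:
`‖v_S‖₂ ≤ (ρ / √s) ‖v_{Sᶜ}‖₁ + τ ‖M v‖₂` for all vectors `v` and all index sets `S` with
`|S| ≤ s`. -/
def L2RNSP {m n : ℕ} (M : Matrix (Fin m) (Fin n) ℝ) (s : ℕ) (ρ τ : ℝ) : Prop :=
  ∀ S : Finset (Fin n), S.card ≤ s → ∀ v : Fin n → ℝ,
    √(∑ j ∈ S, v j ^ 2) ≤
      ρ / √(s : ℝ) * ∑ j ∈ Sᶜ, |v j| + τ * √(∑ i, (M.mulVec v) i ^ 2)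

variable {Ω : Type*} [MeasurableSpace Ω]

/-- `X` is `(κ, α, r)`-reasonable: `‖X‖_p ≤ κ p ^ α` for all real `1 ≤ p ≤ r`. The norm is
`[0, ∞]`-valued, so the bound includes finiteness of the moments. -/
def IsReasonable (P : Measure Ω) (X : Ω → ℝ) (κ α r : ℝ) : Prop :=
  ∀ p : ℝ, 1 ≤ p → p ≤ r → eLpNorm X (ENNReal.ofReal p) P ≤ ENNReal.ofReal (κ * p ^ α)

variable {m n : ℕ}

/-- The random matrix `A` is `k`-central: for each `1 ≤ p ≤ k`, all its entries have the same
`p`-th central moment. -/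
def IsCentral (P : Measure Ω) (A : Ω → Matrix (Fin m) (Fin n) ℝ) (k : ℕ) : Prop :=
  ∀ p : ℕ, 1 ≤ p → p ≤ k → ∀ (i i' : Fin m) (j j' : Fin n),
    centralMoment (fun ω => A ω i j) p P = centralMoment (fun ω => A ω i' j') p P

/-- `μ_k(A)`, the largest absolute value of a `k`-th central moment of an entry of `A`. -/
def maxCentralMoment (P : Measure Ω) (A : Ω → Matrix (Fin m) (Fin n) ℝ) (k : ℕ) : ℝ :=
  ⨆ q : Fin m × Fin n, |centralMoment (fun ω => A ω q.1 q.2) k P|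

/-- `K(A) = μ₂(A)² + μ₃(A) + μ₂(A) μ₃(A) + μ₄(A)`. -/
def momentK (P : Measure Ω) (A : Ω → Matrix (Fin m) (Fin n) ℝ) : ℝ :=
  maxCentralMoment P A 2 ^ 2 + maxCentralMoment P A 3
    + maxCentralMoment P A 2 * maxCentralMoment P A 3 + maxCentralMoment P A 4

/-- The entrywise expectation of `A`. -/
def meanMatrix (P : Measure Ω) (A : Ω → Matrix (Fin m) (Fin n) ℝ) : Matrix (Fin m) (Fin n) ℝ :=
  Matrix.of fun i j => ∫ ω, A ω i j ∂P

/-- `‖M‖_{F,s}`, the largest Frobenius norm of a submatrix of `M` formed by `s` columns. -/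
def localFrobenius (M : Matrix (Fin m) (Fin n) ℝ) (s : ℕ) : ℝ :=
  ⨆ S : {S : Finset (Fin n) // S.card = s}, √(∑ j ∈ S.1, ∑ i, M i j ^ 2)

/-- `‖M‖_∞`, the largest absolute value of an entry of `M`. -/
def maxEntry (M : Matrix (Fin m) (Fin n) ℝ) : ℝ :=
  ⨆ q : Fin m × Fin n, |M q.1 q.2|

/-- `F(A) = min {‖E A‖_{F,s}, √(s log n) ‖E A‖_∞}`. -/
def meanTerm (P : Measure Ω) (A : Ω → Matrix (Fin m) (Fin n) ℝ) (s : ℕ) : ℝ :=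
  min (localFrobenius (meanMatrix P A) s)
    (√((s : ℝ) * Real.log n) * maxEntry (meanMatrix P A))

end RobustNSP

end

/-! The proof is Mendelson's small-ball method. By homogeneity (`l2RNSP_of_unitCone`) it suffices
that `τ ‖A v‖₂ ≥ 1` for every unit vector `v` violating the `ℓ₁` part of the inequality. Put `ξ =
√(μ₂/8)` and `p = μ₂²/(100 K)`. A Paley–Zygmund argument, uniform in the mean of `A`, shows that a
Lipschitz ramp `φ`, supported on `|t| ≥ ξ`, satisfies `E φ(⟨row, v⟩) ≥ p` for every unit `v`
(`IsModel.smallBall_le`). Since `ξ φ(t) ≤ |t|`, Cauchy–Schwarz turns `∑ᵢ φ(⟨rowᵢ, v⟩) ≥ m p / 2`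
into `‖A v‖₂ ≥ ξ √m p / 2`.

Uniformity in `v` comes from the largest deviation of the ramp sums below their means. It changes by
at most `1` when one row changes, so McDiarmid's inequality keeps it within `m p / 4` of its
expectation, with the exponential failure probability of the theorem (`measure_ramp_sum_le`). The
expectation is bounded by symmetrization and contraction (`integral_rampDeviation_le`), which leave
the supremum over the cone of `⟨h, v⟩`, where `h` is the Rademacher sum of the rows. On the cone
this is at most `3/ρ` times the largest `ℓ₂` norm of `s` coordinates of `h`
(`dotProduct_le_of_mem_unitCone`).

That block norm is controlled by moments of order `2k`, with `k` comparable to `log(en/s)`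
(`exists_block_bound`). The condition `m ≥ log(en)^max(2α-1, 1)` ensures that, up to this order,
sums of `m` terms with moments `κ p^α` have moments of Gaussian size (`integral_sum_pow_le`). The
mean matrix enters `h` additively and contributes `F(A)`.

The moment hypothesis reaches order two only when `log(en) ≥ 2`, which holds for `n ≥ 3`. For `n =
1` no supremum is needed. For `n = 2` either `√m p` is large and the common variance alone bounds
the width, or the typical entry is much smaller than `ξ` and pairs of nearly diagonal rows give the
lower bound directly. -/

noncomputable section

namespace RobustNSP

/-! ### Bounded differences on product spaces. -/

section ProductMeasure

variable {E : Type*} [MeasurableSpace E]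

theorem measurePreserving_cons {m : ℕ} (μ : Fin (m + 1) → Measure E)
    [∀ i, IsProbabilityMeasure (μ i)] :
    MeasurePreserving (fun p : E × (Fin m → E) => (Fin.cons p.1 p.2 : Fin (m + 1) → E))
      ((μ 0).prod (Measure.pi fun i => μ i.succ)) (Measure.pi μ) := by
  have h := (measurePreserving_piFinSuccAbove μ 0).symm
  simpa [MeasurableEquiv.piFinSuccAbove_symm_apply, Fin.insertNthEquiv, Fin.insertNth_zero]
    using h

theorem integral_pi_succ {m : ℕ} (μ : Fin (m + 1) → Measure E)
    [∀ i, IsProbabilityMeasure (μ i)] {f : (Fin (m + 1) → E) → ℝ}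
    (hf : Integrable f (Measure.pi μ)) :
    ∫ x, f x ∂Measure.pi μ
      = ∫ x₀, ∫ x, f (Fin.cons x₀ x) ∂(Measure.pi fun i => μ i.succ) ∂(μ 0) := by
  have h := measurePreserving_cons μ
  have hf' : AEStronglyMeasurable f
      (((μ 0).prod (Measure.pi fun i => μ i.succ)).map
        (fun p : E × (Fin m → E) => (Fin.cons p.1 p.2 : Fin (m + 1) → E))) := by
    rw [h.map_eq]; exact hf.aestronglyMeasurable
  rw [← h.map_eq, integral_map h.measurable.aemeasurable hf', integral_prod]
  exact (h.integrable_comp hf.aestronglyMeasurable).2 hf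

/-- Induction on the number of coordinates. Averaging out all coordinates but the first leaves a
function `g` of bounded oscillation, to which Hoeffding's lemma applies; with the first coordinate
frozen, the remaining fluctuation has bounded differences and is covered by the induction
hypothesis. -/
theorem integral_exp_le_of_bounded_differences {m : ℕ} (μ : Fin m → Measure E)
    [∀ i, IsProbabilityMeasure (μ i)] {f : (Fin m → E) → ℝ} (hf : Measurable f)
    {B : ℝ} (hB : ∀ x, |f x| ≤ B) {c : ℝ}
    (hc : ∀ x i y, |f (Function.update x i y) - f x| ≤ c) (t : ℝ) :
    ∫ x, Real.exp (t * (f x - ∫ y, f y ∂Measure.pi μ)) ∂Measure.pi μ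
      ≤ Real.exp (m * c ^ 2 * t ^ 2 / 2) := by
  induction m generalizing B with
  | zero =>
    have : ∀ x, f x = f default := fun x => by congr 1; exact Subsingleton.elim _ _
    simp [this]
  | succ m ih =>
    have hint : ∀ {k : ℕ} (ν : Fin k → Measure E) [∀ i, IsProbabilityMeasure (ν i)]
        (h : (Fin k → E) → ℝ) (_ : Measurable h) (_ : ∀ x, |h x| ≤ B), Integrable h (Measure.pi ν) :=
      fun ν _ h hm hb => Integrable.of_bound hm.aestronglyMeasurable B (.of_forall fun x => by
        simpa using hb x)
    have hcons : Measurable fun p : E × (Fin m → E) => (Fin.cons p.1 p.2 : Fin (m + 1) → E) :=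
      (measurePreserving_cons μ).measurable
    have hB0 : 0 ≤ B := by
      obtain ⟨x⟩ : Nonempty (Fin (m + 1) → E) := by
        by_contra h
        rw [not_nonempty_iff] at h
        exact IsProbabilityMeasure.ne_zero (Measure.pi μ) (Measure.eq_zero_of_isEmpty _)
      exact (abs_nonneg _).trans (hB x)
    set ν := fun i : Fin m => μ i.succ with hν
    set g : E → ℝ := fun x₀ => ∫ x, f (Fin.cons x₀ x) ∂Measure.pi ν with hg
    have hgm : Measurable g :=
      ((hf.comp hcons).stronglyMeasurable.integral_prod_right').measurable
    have hfx : ∀ x₀, Measurable fun x : Fin m → E => f (Fin.cons x₀ x) := fun x₀ =>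
      (hf.comp hcons).comp measurable_prodMk_left
    have hIf : ∫ x, f x ∂Measure.pi μ = ∫ x₀, g x₀ ∂μ 0 :=
      integral_pi_succ μ (hint μ f hf hB)
    have hgB : ∀ x₀, |g x₀| ≤ B := fun x₀ => by
      have := norm_integral_le_of_norm_le_const (μ := Measure.pi ν) (C := B)
        (f := fun x => f (Fin.cons x₀ x)) (.of_forall fun x => by simpa using hB _)
      simpa using this
    set I := ∫ x, f x ∂Measure.pi μ with hI
    have hIB : |I| ≤ B := by
      have := norm_integral_le_of_norm_le_const (μ := Measure.pi μ) (C := B)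
        (f := f) (.of_forall fun x => by simpa using hB _)
      simpa using this
    have hgc : ∀ x₀ y₀, |g x₀ - g y₀| ≤ c := fun x₀ y₀ => by
      rw [hg]
      simp only
      rw [← integral_sub (hint ν _ (hfx _) fun x => hB _) (hint ν _ (hfx _) fun x => hB _)]
      have := norm_integral_le_of_norm_le_const (μ := Measure.pi ν) (C := c)
        (f := fun x => f (Fin.cons x₀ x) - f (Fin.cons y₀ x)) (.of_forall fun x => by
          have := hc (Fin.cons y₀ x) 0 x₀
          rwa [Fin.update_cons_zero] at this)
      simpa using this
    have hexpint : Integrable (fun x => Real.exp (t * (f x - I))) (Measure.pi μ) := by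
      refine Integrable.of_bound (by fun_prop) (Real.exp (|t| * (B + B))) (.of_forall fun x => ?_)
      rw [Real.norm_eq_abs, Real.abs_exp, Real.exp_le_exp]
      calc t * (f x - I) ≤ |t * (f x - I)| := le_abs_self _
        _ ≤ _ := by
          rw [abs_mul]
          exact mul_le_mul_of_nonneg_left ((abs_sub _ _).trans (add_le_add (hB _) hIB))
            (abs_nonneg _)
    rw [integral_pi_succ μ hexpint]
    have hinner : ∀ x₀, ∫ x, Real.exp (t * (f (Fin.cons x₀ x) - I)) ∂Measure.pi ν
        ≤ Real.exp (t * (g x₀ - I)) * Real.exp (m * c ^ 2 * t ^ 2 / 2) := fun x₀ => by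
      have h1 : ∀ x, Real.exp (t * (f (Fin.cons x₀ x) - I))
          = Real.exp (t * (g x₀ - I)) * Real.exp (t * (f (Fin.cons x₀ x) - g x₀)) := fun x => by
        rw [← Real.exp_add]; congr 1; ring
      simp only [h1]
      rw [integral_const_mul]
      refine mul_le_mul_of_nonneg_left ?_ (Real.exp_pos _).le
      refine ih ν (f := fun x => f (Fin.cons x₀ x)) (hfx x₀) (fun x => hB _) fun x i y => ?_
      have := hc (Fin.cons x₀ x) i.succ y
      rwa [← Fin.cons_update] at this
    have hsub : HasSubgaussianMGF (fun x₀ => g x₀ - ∫ y, g y ∂μ 0)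
        ((‖(c : ℝ)‖₊ : NNReal) ^ 2) (μ 0) := by
      obtain ⟨y₀⟩ : Nonempty E := by
        by_contra h
        rw [not_nonempty_iff] at h
        exact IsProbabilityMeasure.ne_zero (μ 0) (Measure.eq_zero_of_isEmpty _)
      -- The values of `g` lie within `c` of `g y₀`, an interval of length `2c`, so Hoeffding's
      -- variance proxy is `c²`.
      have := hasSubgaussianMGF_of_mem_Icc (μ := μ 0) (X := g) (a := g y₀ - c) (b := g y₀ + c)
        hgm.aemeasurable (.of_forall fun x => by
          have := abs_le.1 (hgc x y₀)
          constructor <;> linarith)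
      convert this using 1
      congr 1
      have : g y₀ + c - (g y₀ - c) = c * 2 := by ring
      rw [this, nnnorm_mul]
      simp
    calc ∫ x₀, ∫ x, Real.exp (t * (f (Fin.cons x₀ x) - I)) ∂Measure.pi ν ∂μ 0
        ≤ ∫ x₀, Real.exp (t * (g x₀ - I)) * Real.exp (m * c ^ 2 * t ^ 2 / 2) ∂μ 0 := by
          refine integral_mono_of_nonneg (.of_forall fun x₀ => integral_nonneg fun x => (Real.exp_pos _).le)
            ?_ (.of_forall hinner)
          refine Integrable.mul_const ?_ _
          rw [hIf]
          exact hsub.integrable_exp_mul t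
      _ ≤ Real.exp (c ^ 2 * t ^ 2 / 2) * Real.exp (m * c ^ 2 * t ^ 2 / 2) := by
          rw [integral_mul_const]
          refine mul_le_mul_of_nonneg_right ?_ (Real.exp_pos _).le
          have := hsub.mgf_le t
          rw [mgf, ← hIf] at this
          simpa using this
      _ = _ := by
          rw [← Real.exp_add]; congr 1; push_cast; ring

/-- **McDiarmid's inequality** (with a non-optimal constant). -/
theorem measure_ge_le_of_bounded_differences {m : ℕ} (μ : Fin m → Measure E)
    [∀ i, IsProbabilityMeasure (μ i)] {f : (Fin m → E) → ℝ} (hf : Measurable f)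
    {B : ℝ} (hB : ∀ x, |f x| ≤ B)
    (hc : ∀ x i y, |f (Function.update x i y) - f x| ≤ 1) {t : ℝ} (ht : 0 ≤ t) :
    (Measure.pi μ).real {x | (∫ y, f y ∂Measure.pi μ) + t ≤ f x}
      ≤ Real.exp (- t ^ 2 / (2 * m)) := by
  have hsub : HasSubgaussianMGF (fun x => f x - ∫ y, f y ∂Measure.pi μ) (m : NNReal)
      (Measure.pi μ) := by
    refine ⟨fun t => ?_, fun t => ?_⟩
    · refine Integrable.of_bound (by fun_prop) (Real.exp (|t| * (B + B)))
        (.of_forall fun x => ?_)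
      rw [Real.norm_eq_abs, Real.abs_exp, Real.exp_le_exp]
      have hIB : |∫ y, f y ∂Measure.pi μ| ≤ B := by
        have := norm_integral_le_of_norm_le_const (μ := Measure.pi μ) (C := B)
          (f := f) (.of_forall fun x => by simpa using hB _)
        simpa using this
      refine (le_abs_self _).trans ?_
      rw [abs_mul]
      exact mul_le_mul_of_nonneg_left ((abs_sub _ _).trans (add_le_add (hB _) hIB))
        (abs_nonneg _)
    · have := integral_exp_le_of_bounded_differences μ hf hB hc t
      simpa [mgf] using this
  have := hsub.measure_ge_le ht
  simp only [le_sub_iff_add_le'] at this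
  simpa using this

end ProductMeasure

/-! ### Symmetrization and contraction for finite suprema. -/

section FiniteSup

variable {V : Type*} [Finite V]

theorem le_iSup_finite (g : V → ℝ) (v : V) : g v ≤ ⨆ v, g v :=
  le_ciSup (Set.finite_range g).bddAbove v

theorem abs_iSup_sub_iSup_le [Nonempty V] {g h : V → ℝ} {c : ℝ} (H : ∀ v, |g v - h v| ≤ c) :
    |(⨆ v, g v) - ⨆ v, h v| ≤ c := by
  rw [abs_sub_le_iff]
  constructor
  · rw [sub_le_iff_le_add]
    exact ciSup_le fun v => by
      have := (abs_le.1 (H v)).2; have := le_iSup_finite h v; linarith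
  · rw [sub_le_iff_le_add]
    exact ciSup_le fun v => by
      have := (abs_le.1 (H v)).1; have := le_iSup_finite g v; linarith

theorem integrable_iSup {X : Type*} [MeasurableSpace X] {μ : Measure X} [Nonempty V]
    {g : V → X → ℝ} (hm : ∀ v, Measurable (g v)) (hg : ∀ v, Integrable (g v) μ) :
    Integrable (fun x => ⨆ v, g v x) μ := by
  have := Fintype.ofFinite V
  refine Integrable.mono' (g := fun x => ∑ v, |g v x|) (integrable_finsetSum _ fun v _ => (hg v).abs)
    (Measurable.iSup hm).aestronglyMeasurable (.of_forall fun x => ?_)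
  obtain ⟨v, hv⟩ := exists_eq_ciSup_of_finite (f := fun v => g v x)
  rw [← hv, Real.norm_eq_abs]
  exact Finset.single_le_sum (f := fun v => |g v x|) (fun v _ => abs_nonneg _) (Finset.mem_univ v)

theorem integrable_sum_pi {E : Type*} [MeasurableSpace E] {m : ℕ} {μ : Fin m → Measure E}
    [∀ i, IsProbabilityMeasure (μ i)] {g : Fin m → E → ℝ} (hg : ∀ i, Integrable (g i) (μ i)) :
    Integrable (fun x : Fin m → E => ∑ i, g i (x i)) (Measure.pi μ) :=
  integrable_finsetSum _ fun i _ =>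
    ((measurePreserving_eval μ i).integrable_comp (hg i).aestronglyMeasurable).2 (hg i)

/-- Comparison of expected suprema of sums of independent terms, from a comparison of each term
in the presence of an arbitrary drift. -/
theorem integral_iSup_add_sum_le {E E' : Type*} [MeasurableSpace E] [MeasurableSpace E']
    [Nonempty V] {m : ℕ} (μ : Fin m → Measure E) (ν : Fin m → Measure E')
    [∀ i, IsProbabilityMeasure (μ i)] [∀ i, IsProbabilityMeasure (ν i)]
    {g : Fin m → V → E → ℝ} {g' : Fin m → V → E' → ℝ}
    (hgm : ∀ i v, Measurable (g i v)) (hgm' : ∀ i v, Measurable (g' i v))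
    (hg : ∀ i v, Integrable (g i v) (μ i)) (hg' : ∀ i v, Integrable (g' i v) (ν i))
    (hstep : ∀ i (c : V → ℝ), ∫ x, ⨆ v, (c v + g i v x) ∂μ i ≤ ∫ y, ⨆ v, (c v + g' i v y) ∂ν i)
    (c : V → ℝ) :
    ∫ x, ⨆ v, (c v + ∑ i, g i v (x i)) ∂Measure.pi μ
      ≤ ∫ y, ⨆ v, (c v + ∑ i, g' i v (y i)) ∂Measure.pi ν := by
  induction m generalizing c with
  | zero => simp
  | succ m ih =>
    set μ' := fun i : Fin m => μ i.succ
    set ν' := fun i : Fin m => ν i.succ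
    have hI : Integrable (fun x : Fin (m + 1) → E => ⨆ v, (c v + ∑ i, g i v (x i)))
        (Measure.pi μ) :=
      integrable_iSup (fun v => by fun_prop) fun v =>
        (integrable_const _).add (integrable_sum_pi fun i => hg i v)
    have hI' : Integrable (fun x : Fin (m + 1) → E' => ⨆ v, (c v + ∑ i, g' i v (x i)))
        (Measure.pi ν) :=
      integrable_iSup (fun v => by fun_prop) fun v =>
        (integrable_const _).add (integrable_sum_pi fun i => hg' i v)
    rw [integral_pi_succ μ hI, integral_pi_succ ν hI']
    simp only [Fin.sum_univ_succ, Fin.cons_zero, Fin.cons_succ]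
    have hs : ∀ v, Integrable (fun x : Fin m → E => ∑ i, g i.succ v (x i)) (Measure.pi μ') :=
      fun v => integrable_sum_pi (μ := μ') (g := fun i => g i.succ v) fun i => hg i.succ v
    have hs' : ∀ v, Integrable (fun x : Fin m → E' => ∑ i, g' i.succ v (x i)) (Measure.pi ν') :=
      fun v => integrable_sum_pi (μ := ν') (g := fun i => g' i.succ v) fun i => hg' i.succ v
    have hP : Integrable (fun p : E × (Fin m → E) =>
        ⨆ v, (c v + (g 0 v p.1 + ∑ i, g i.succ v (p.2 i)))) ((μ 0).prod (Measure.pi μ')) :=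
      integrable_iSup (fun v => by fun_prop) fun v =>
        (integrable_const _).add (((hg 0 v).comp_fst _).add ((hs v).comp_snd _))
    have hM : Integrable (fun p : E × (Fin m → E') =>
        ⨆ v, (c v + (g 0 v p.1 + ∑ i, g' i.succ v (p.2 i)))) ((μ 0).prod (Measure.pi ν')) :=
      integrable_iSup (fun v => by fun_prop) fun v =>
        (integrable_const _).add (((hg 0 v).comp_fst _).add ((hs' v).comp_snd _))
    have hP' : Integrable (fun p : E' × (Fin m → E') =>
        ⨆ v, (c v + (g' 0 v p.1 + ∑ i, g' i.succ v (p.2 i)))) ((ν 0).prod (Measure.pi ν')) :=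
      integrable_iSup (fun v => by fun_prop) fun v =>
        (integrable_const _).add (((hg' 0 v).comp_fst _).add ((hs' v).comp_snd _))
    -- First the tail coordinates are exchanged, with `c + g 0 · x₀` as drift; then Fubini lets the
    -- first coordinate be exchanged, with the new tail sum as drift. This is why the drift must be
    -- arbitrary.
    calc _ ≤ ∫ x₀, ∫ y, ⨆ v, (c v + (g 0 v x₀ + ∑ i, g' i.succ v (y i))) ∂Measure.pi ν' ∂μ 0 := by
          refine integral_mono hP.integral_prod_left hM.integral_prod_left fun x₀ => ?_
          have := ih μ' ν' (fun i v => hgm i.succ v) (fun i v => hgm' i.succ v)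
            (fun i v => hg i.succ v) (fun i v => hg' i.succ v) (fun i c => hstep i.succ c)
            (fun v => c v + g 0 v x₀)
          simpa only [add_assoc] using this
      _ = ∫ y, ∫ x₀, ⨆ v, (c v + (g 0 v x₀ + ∑ i, g' i.succ v (y i))) ∂μ 0 ∂Measure.pi ν' :=
          integral_integral_swap hM
      _ ≤ ∫ y, ∫ y₀, ⨆ v, (c v + (g' 0 v y₀ + ∑ i, g' i.succ v (y i))) ∂ν 0 ∂Measure.pi ν' := by
          refine integral_mono hM.integral_prod_right hP'.integral_prod_right fun y => ?_
          have := hstep 0 (fun v => c v + ∑ i, g' i.succ v (y i))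
          simpa only [add_assoc, add_comm (∑ i, g' i.succ _ (y i))] using this
      _ = _ := (integral_integral_swap hP').symm

/-- The uniform measure on `{1, -1}`. -/
def rademacher : Measure ℝ :=
  (2⁻¹ : NNReal) • Measure.dirac 1 + (2⁻¹ : NNReal) • Measure.dirac (-1)

instance : IsProbabilityMeasure rademacher := ⟨by
  simp only [rademacher, Measure.add_apply, Measure.smul_apply, measure_univ]
  rw [ENNReal.smul_def, smul_eq_mul, mul_one]
  norm_cast
  rw [← two_mul]
  exact mul_inv_cancel₀ two_ne_zero⟩

theorem integral_rademacher (f : ℝ → ℝ) :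
    ∫ e, f e ∂rademacher = (f 1 + f (-1)) / 2 := by
  rw [rademacher, integral_add_measure, integral_smul_nnreal_measure, integral_smul_nnreal_measure]
  · simp [NNReal.smul_def]; ring
  all_goals exact Integrable.smul_measure_nnreal (integrable_dirac (by simp))

theorem integrable_rademacher (f : ℝ → ℝ) : Integrable f rademacher :=
  (Integrable.smul_measure_nnreal (integrable_dirac (by simp))).add_measure
    (Integrable.smul_measure_nnreal (integrable_dirac (by simp)))

theorem integrable_snd_mul_fst {E : Type*} [MeasurableSpace E] {μ : Measure E}
    [IsProbabilityMeasure μ] {f : E → ℝ} (hf : Integrable f μ) (r : ℝ) :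
    Integrable (fun y : E × ℝ => r * (y.2 * f y.1)) (μ.prod rademacher) := by
  have := (hf.mul_prod (integrable_rademacher fun e => e)).const_mul r
  simpa [mul_comm] using this

/-- Symmetrization and contraction for a single independent term. -/
theorem integral_iSup_sub_le_rademacher {E : Type*} [MeasurableSpace E] [Nonempty V]
    (μ : Measure E) [IsProbabilityMeasure μ] {f : V → E → ℝ} (hfm : ∀ v, Measurable (f v))
    (hf : ∀ v, Integrable (f v) μ) {φ : ℝ → ℝ} (hφm : Measurable φ) {B : ℝ} (hB : ∀ t, |φ t| ≤ B)
    {L : ℝ} (hL : ∀ s t, φ s - φ t ≤ L * |s - t|) (c : V → ℝ) :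
    ∫ x, ⨆ v, (c v + ((∫ y, φ (f v y) ∂μ) - φ (f v x))) ∂μ
      ≤ ∫ y, ⨆ v, (c v + 2 * L * (y.2 * f v y.1)) ∂(μ.prod rademacher) := by
  have hφ : ∀ v, Integrable (fun x => φ (f v x)) μ := fun v =>
    Integrable.of_bound (hφm.comp (hfm v)).aestronglyMeasurable B (.of_forall fun x => hB _)
  have hR : Integrable (fun y : E × ℝ => ⨆ v, (c v + 2 * L * (y.2 * f v y.1)))
      (μ.prod rademacher) :=
    integrable_iSup (fun v => by fun_prop) fun v =>
      (integrable_const _).add (integrable_snd_mul_fst (hf v) _)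
  have hpos : Integrable (fun x => ⨆ v, (c v + 2 * φ (f v x))) μ :=
    integrable_iSup (fun v => by fun_prop) fun v => (integrable_const _).add ((hφ v).const_mul _)
  have hneg : Integrable (fun x => ⨆ v, (c v - 2 * φ (f v x))) μ :=
    integrable_iSup (fun v => by fun_prop) fun v => (integrable_const _).sub ((hφ v).const_mul _)
  have hpos' : Integrable (fun x => ⨆ v, (c v + 2 * L * (1 * f v x))) μ :=
    integrable_iSup (fun v => by fun_prop) fun v =>
      (integrable_const _).add (((hf v).const_mul 1).const_mul _)
  have hneg' : Integrable (fun x => ⨆ v, (c v + 2 * L * (-1 * f v x))) μ :=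
    integrable_iSup (fun v => by fun_prop) fun v =>
      (integrable_const _).add (((hf v).const_mul (-1)).const_mul _)
  -- Write `c + a - b` as the average of `c + 2a` and `c - 2b`. The supremum splits, and the one
  -- containing the mean moves inside the integral, so no independent copy of the variable is
  -- needed.
  have hdec : ∀ x, ⨆ v, (c v + ((∫ y, φ (f v y) ∂μ) - φ (f v x)))
      ≤ ((∫ y, ⨆ v, (c v + 2 * φ (f v y)) ∂μ) + ⨆ v, (c v - 2 * φ (f v x))) / 2 := fun x => by
    refine ciSup_le fun v => ?_
    have h1 : ∫ y, (c v + 2 * φ (f v y)) ∂μ ≤ ∫ y, ⨆ v, (c v + 2 * φ (f v y)) ∂μ :=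
      integral_mono ((integrable_const _).add ((hφ v).const_mul _)) hpos
        fun y => le_iSup_finite (fun v => c v + 2 * φ (f v y)) v
    rw [integral_add (integrable_const _) ((hφ v).const_mul _), integral_const_mul] at h1
    simp only [integral_const, probReal_univ, one_smul] at h1
    have h2 := le_iSup_finite (fun v => c v - 2 * φ (f v x)) v
    linarith
  -- Take maximizers `v` and `w` of the two suprema. The Lipschitz bound produces `|f v x - f w x|`,
  -- whose sign decides which of `v`, `w` is tested with `+1` on the right.
  have hcontr : ∀ x, (⨆ v, (c v + 2 * φ (f v x))) + ⨆ v, (c v - 2 * φ (f v x))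
      ≤ (⨆ v, (c v + 2 * L * (1 * f v x))) + ⨆ v, (c v + 2 * L * (-1 * f v x)) := fun x => by
    obtain ⟨v, hv⟩ := exists_eq_ciSup_of_finite (f := fun v => c v + 2 * φ (f v x))
    obtain ⟨w, hw⟩ := exists_eq_ciSup_of_finite (f := fun v => c v - 2 * φ (f v x))
    rw [← hv, ← hw]
    have hvw := hL (f v x) (f w x)
    have h1 := le_iSup_finite (fun v => c v + 2 * L * (1 * f v x))
    have h2 := le_iSup_finite (fun v => c v + 2 * L * (-1 * f v x))
    rcases abs_cases (f v x - f w x) with ⟨h, _⟩ | ⟨h, _⟩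
    · rw [h] at hvw
      linarith [h1 v, h2 w]
    · rw [h] at hvw
      linarith [h1 w, h2 v]
  have hL1 : Integrable (fun x => ⨆ v, (c v + ((∫ y, φ (f v y) ∂μ) - φ (f v x)))) μ :=
    integrable_iSup (fun v => by fun_prop) fun v =>
      (integrable_const _).add ((integrable_const _).sub (hφ v))
  rw [integral_prod _ hR]
  simp only [integral_rademacher]
  calc _ ≤ ∫ x, ((∫ y, ⨆ v, (c v + 2 * φ (f v y)) ∂μ) + ⨆ v, (c v - 2 * φ (f v x))) / 2 ∂μ :=
        integral_mono hL1 (((integrable_const _).add hneg).div_const 2) hdec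
    _ = ∫ x, ((⨆ v, (c v + 2 * φ (f v x))) + ⨆ v, (c v - 2 * φ (f v x))) / 2 ∂μ := by
        rw [integral_div, integral_div, integral_add (integrable_const _) hneg,
          integral_add hpos hneg]
        simp
    _ ≤ _ := integral_mono ((hpos.add hneg).div_const 2) ((hpos'.add hneg').div_const 2)
        fun x => div_le_div_of_nonneg_right (hcontr x) (by norm_num)

end FiniteSup

/-! ### Moments of sums of independent variables. -/

section Moments

variable {Ω : Type*} [MeasurableSpace Ω] {P : Measure Ω}

/-- Disjoint blocks of an independent family of random variables are independent. -/
theorem iIndepFun_curry [IsProbabilityMeasure P] {ι κ : Type*} [Finite ι] [Finite κ]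
    {X : ι × κ → Ω → ℝ} (hX : ∀ q, Measurable (X q)) (h : iIndepFun X P) :
    iIndepFun (fun (i : ι) (ω : Ω) (j : κ) => X (i, j) ω) P := by
  have hp : ∀ i j, IsProbabilityMeasure (P.map (X (i, j))) :=
    fun i j => Measure.isProbabilityMeasure_map (hX _).aemeasurable
  have hrow : ∀ i, P.map (fun ω j => X (i, j) ω) = Measure.infinitePi fun j => P.map (X (i, j)) :=
    fun i => iIndepFun.map_fun_eq_infinitePi_map (fun j => hX _)
      (h.precomp (g := fun j => (i, j)) fun j j' hj => by simpa using hj)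
  rw [iIndepFun_iff_map_fun_eq_infinitePi_map (by fun_prop)]
  simp only [hrow]
  have h2 := Measure.infinitePi_map_curry (fun i j => P.map (X (i, j)))
  rw [← h2, ← h.map_fun_eq_infinitePi_map hX, Measure.map_map (by fun_prop) (by fun_prop)]
  rfl

theorem integrable_pow_of_memLp [IsFiniteMeasure P] {X : Ω → ℝ} {N : ℕ} (hX : MemLp X N P)
    {p : ℕ} (hp : p ≤ N) : Integrable (fun ω => X ω ^ p) P := by
  have h : MemLp X p P := hX.mono_exponent (by exact_mod_cast hp)
  refine h.integrable_norm_pow'.mono' (hX.aestronglyMeasurable.pow p) (.of_forall fun ω => ?_)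
  simp

theorem integral_add_pow_of_indepFun [IsFiniteMeasure P] {S Y : Ω → ℝ} (h : IndepFun S Y P)
    {N : ℕ} (hS : MemLp S N P) (hY : MemLp Y N P) {p : ℕ} (hp : p ≤ N) :
    ∫ ω, (S ω + Y ω) ^ p ∂P
      = ∑ r ∈ Finset.range (p + 1), (∫ ω, S ω ^ r ∂P) * (∫ ω, Y ω ^ (p - r) ∂P) * p.choose r := by
  have hind : ∀ r q : ℕ, IndepFun (fun ω => S ω ^ r) (fun ω => Y ω ^ q) P := fun r q =>
    h.comp (φ := fun x => x ^ r) (ψ := fun x => x ^ q) (by fun_prop) (by fun_prop)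
  simp only [add_pow]
  rw [integral_finsetSum]
  · refine Finset.sum_congr rfl fun r hr => ?_
    rw [integral_mul_const, (hind r (p - r)).integral_fun_mul_eq_mul_integral
      (hS.aestronglyMeasurable.pow r) (hY.aestronglyMeasurable.pow _)]
  · intro r hr
    rw [Finset.mem_range] at hr
    exact ((hind r (p - r)).integrable_mul (integrable_pow_of_memLp hS (by omega))
      (integrable_pow_of_memLp hY (by omega))).mul_const _

/-- When one term is added, every binomial contribution with a first-moment factor vanishes, so
third moments never matter. In the fourth moment only the cross term `6 σ² T (v a)²` remains; `σ² ≤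
K` fits it into the expansion of `3K (T + (v a)²)²`. -/
theorem moments_sum_of_centered [IsProbabilityMeasure P] {ι : Type*} {X : ι → Ω → ℝ}
    (hind : iIndepFun X P) (hm : ∀ j, Measurable (X j)) (h4 : ∀ j, MemLp (X j) 4 P)
    (h1 : ∀ j, ∫ ω, X j ω ∂P = 0) {σ K : ℝ} (h2 : ∀ j, ∫ ω, X j ω ^ 2 ∂P = σ)
    (hK : ∀ j, ∫ ω, X j ω ^ 4 ∂P ≤ K) (hσK : σ ^ 2 ≤ K) (v : ι → ℝ) (s : Finset ι) :
    ∫ ω, (∑ j ∈ s, v j * X j ω) ∂P = 0 ∧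
    ∫ ω, (∑ j ∈ s, v j * X j ω) ^ 2 ∂P = σ * ∑ j ∈ s, v j ^ 2 ∧
    ∫ ω, (∑ j ∈ s, v j * X j ω) ^ 4 ∂P ≤ 3 * K * (∑ j ∈ s, v j ^ 2) ^ 2 := by
  classical
  induction s using Finset.induction_on with
  | empty => simp
  | insert a s ha ih =>
    obtain ⟨i1, i2, i4⟩ := ih
    have hK0 : 0 ≤ K := (sq_nonneg σ).trans hσK
    set S : Ω → ℝ := fun ω => ∑ j ∈ s, v j * X j ω with hS
    set Y : Ω → ℝ := fun ω => v a * X a ω with hY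
    change ∫ ω, S ω ^ 2 ∂P = _ at i2
    change ∫ ω, S ω ^ 4 ∂P ≤ _ at i4
    have hSm : MemLp S (4 : ℕ) P := memLp_finsetSum s fun j _ => (h4 j).const_mul (v j)
    have hYm : MemLp Y (4 : ℕ) P := (h4 a).const_mul (v a)
    have hSY : IndepFun S Y P := by
      have h' : iIndepFun (fun j ω => v j * X j ω) P :=
        hind.comp (fun j x => v j * x) fun j => by fun_prop
      have := h'.indepFun_finsetSum_of_notMem (fun j => by fun_prop) ha
      convert this using 1
      ext ω; simp [hS]
    have y1 : ∫ ω, Y ω ∂P = 0 := by rw [hY, integral_const_mul, h1, mul_zero]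
    have y2 : ∫ ω, Y ω ^ 2 ∂P = v a ^ 2 * σ := by
      simp only [hY, mul_pow]; rw [integral_const_mul, h2]
    have y4 : ∫ ω, Y ω ^ 4 ∂P ≤ v a ^ 4 * K := by
      simp only [hY, mul_pow]; rw [integral_const_mul]
      exact mul_le_mul_of_nonneg_left (hK a) (by positivity)
    have e2 := integral_add_pow_of_indepFun hSY hSm hYm (p := 2) (by norm_num)
    have e4 := integral_add_pow_of_indepFun hSY hSm hYm (p := 4) (by norm_num)
    simp only [Finset.sum_range_succ, Finset.sum_range_zero, pow_zero, pow_one, i1, y1, y2, i2,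
      Nat.sub_zero, Nat.sub_self, integral_const, probReal_univ, one_smul, Nat.reduceSub,
      Nat.choose, Nat.reduceAdd] at e2 e4
    have hsplit : ∀ ω, ∑ j ∈ insert a s, v j * X j ω = S ω + Y ω := fun ω => by
      rw [Finset.sum_insert ha, add_comm]
    simp only [hsplit, Finset.sum_insert ha]
    set T := ∑ j ∈ s, v j ^ 2 with hT
    have hT0 : 0 ≤ T := Finset.sum_nonneg fun j _ => sq_nonneg _
    refine ⟨?_, ?_, ?_⟩
    · rw [integral_add, i1, y1, add_zero]
      · exact hSm.integrable (by norm_num)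
      · exact hYm.integrable (by norm_num)
    · rw [e2]; push_cast; ring
    · rw [e4]
      have hx : 0 ≤ T * v a ^ 2 := mul_nonneg hT0 (sq_nonneg _)
      have := mul_le_mul_of_nonneg_left hσK hx
      have := mul_nonneg (pow_nonneg (sq_nonneg (v a)) 2) hK0
      push_cast
      nlinarith

theorem sum_range_convolution_le {a b : ℕ → ℝ} (ha : ∀ i, 0 ≤ a i) (hb : ∀ i, 0 ≤ b i) (N : ℕ) :
    ∑ p ∈ Finset.range N, ∑ r ∈ Finset.range (p + 1), a r * b (p - r)
      ≤ (∑ p ∈ Finset.range N, a p) * ∑ p ∈ Finset.range N, b p := by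
  rw [Finset.sum_comm' (t' := Finset.range N) (s' := fun r => Finset.Ico r N)
    (by intro x y; simp only [Finset.mem_range, Finset.mem_Ico]; omega), Finset.sum_mul]
  refine Finset.sum_le_sum fun r _ => ?_
  rw [← Finset.mul_sum, Finset.sum_Ico_eq_sum_range]
  refine mul_le_mul_of_nonneg_left ?_ (ha r)
  simp only [Nat.add_sub_cancel_left]
  exact Finset.sum_le_sum_of_subset_of_nonneg (Finset.range_subset_range.2 (by omega))
    fun i _ _ => hb i

/-- A generating function bound for the moments of a sum of independent variables whose odd
moments vanish. -/
theorem sum_moments_le_pow [IsProbabilityMeasure P] {ι : Type*} {Y : ι → Ω → ℝ}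
    (hind : iIndepFun Y P) (hm : ∀ j, Measurable (Y j)) {k : ℕ}
    (hL : ∀ j, MemLp (Y j) (2 * k : ℕ) P)
    (hodd : ∀ j p, Odd p → p ≤ 2 * k → ∫ ω, Y j ω ^ p ∂P = 0) {z G : ℝ} (hz : 0 ≤ z)
    (hG : ∀ j, ∑ p ∈ Finset.range (2 * k + 1), (∫ ω, Y j ω ^ p ∂P) / p.factorial * z ^ p ≤ G)
    (s : Finset ι) :
    (∀ p, Odd p → p ≤ 2 * k → ∫ ω, (∑ j ∈ s, Y j ω) ^ p ∂P = 0) ∧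
    ∑ p ∈ Finset.range (2 * k + 1), (∫ ω, (∑ j ∈ s, Y j ω) ^ p ∂P) / p.factorial * z ^ p
      ≤ G ^ s.card := by
  classical
  induction s using Finset.induction_on with
  | empty =>
    refine ⟨fun p hp _ => ?_, ?_⟩
    · simp [hp.pos.ne']
    · rw [Finset.sum_eq_single 0]
      · simp
      · intro p _ hp; simp [hp]
      · simp
  | insert a s ha ih =>
    obtain ⟨iodd, ih⟩ := ih
    set S : Ω → ℝ := fun ω => ∑ j ∈ s, Y j ω with hS
    have hSm : MemLp S (2 * k : ℕ) P := memLp_finsetSum s fun j _ => hL j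
    have hSY : IndepFun S (Y a) P := by
      have := hind.indepFun_finsetSum_of_notMem hm ha
      convert this using 1
      ext ω; simp [hS]
    have hsplit : ∀ ω, ∑ j ∈ insert a s, Y j ω = S ω + Y a ω := fun ω => by
      rw [Finset.sum_insert ha, add_comm]
    simp only [hsplit]
    have hexp : ∀ p ≤ 2 * k, ∫ ω, (S ω + Y a ω) ^ p ∂P = _ := fun p hp =>
      integral_add_pow_of_indepFun hSY hSm (hL a) hp
    have key : ∀ X : Ω → ℝ, (∀ p, Odd p → p ≤ 2 * k → ∫ ω, X ω ^ p ∂P = 0) →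
        ∀ p, p ≤ 2 * k → 0 ≤ (∫ ω, X ω ^ p ∂P) / p.factorial * z ^ p := fun X hX p hp => by
      rcases Nat.even_or_odd p with he | ho
      · have : 0 ≤ ∫ ω, X ω ^ p ∂P := integral_nonneg fun ω => he.pow_nonneg _
        positivity
      · rw [hX p ho hp]; simp
    refine ⟨fun p hp hpk => ?_, ?_⟩
    · rw [hexp p hpk]
      refine Finset.sum_eq_zero fun r hr => ?_
      rw [Finset.mem_range] at hr
      rcases Nat.even_or_odd r with he | ho
      · rw [hodd a (p - r) (Nat.Odd.sub_even (by omega) hp he) (by omega)]; ring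
      · rw [iodd r ho (by omega)]; ring
    -- By the binomial theorem the moments divided by factorials convolve like a Cauchy product.
    -- Setting the coefficients to zero beyond `2k` makes them nonnegative at every index, as the
    -- convolution inequality requires.
    · set α : ℕ → ℝ := fun p => if p ≤ 2 * k then (∫ ω, S ω ^ p ∂P) / p.factorial * z ^ p else 0
        with hα
      set β : ℕ → ℝ := fun p => if p ≤ 2 * k then (∫ ω, Y a ω ^ p ∂P) / p.factorial * z ^ p else 0
        with hβ
      have hα0 : ∀ p, 0 ≤ α p := fun p => by
        simp only [hα]; split_ifs with h
        · exact key S iodd p h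
        · exact le_rfl
      have hβ0 : ∀ p, 0 ≤ β p := fun p => by
        simp only [hβ]; split_ifs with h
        · exact key (Y a) (hodd a) p h
        · exact le_rfl
      have hsα : ∑ p ∈ Finset.range (2 * k + 1), α p ≤ G ^ s.card := by
        refine le_trans (le_of_eq (Finset.sum_congr rfl fun p hp => ?_)) ih
        rw [Finset.mem_range] at hp
        simp only [hα, hS, if_pos (show p ≤ 2 * k by omega)]
      have hsβ : ∑ p ∈ Finset.range (2 * k + 1), β p ≤ G := by
        refine le_trans (le_of_eq (Finset.sum_congr rfl fun p hp => ?_)) (hG a)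
        rw [Finset.mem_range] at hp
        simp only [hβ, if_pos (show p ≤ 2 * k by omega)]
      have hterm : ∀ p ∈ Finset.range (2 * k + 1),
          (∫ ω, (S ω + Y a ω) ^ p ∂P) / p.factorial * z ^ p
            = ∑ r ∈ Finset.range (p + 1), α r * β (p - r) := fun p hp => by
        rw [Finset.mem_range] at hp
        rw [hexp p (by omega), Finset.sum_div, Finset.sum_mul]
        refine Finset.sum_congr rfl fun r hr => ?_
        rw [Finset.mem_range] at hr
        simp only [hα, hβ, if_pos (show r ≤ 2 * k by omega), if_pos (show p - r ≤ 2 * k by omega)]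
        rw [Nat.cast_choose ℝ (show r ≤ p by omega)]
        have hzp : z ^ p = z ^ r * z ^ (p - r) := by rw [← pow_add]; congr 1; omega
        rw [hzp]
        have := Nat.factorial_ne_zero p
        have := Nat.factorial_ne_zero r
        have := Nat.factorial_ne_zero (p - r)
        field_simp
      rw [Finset.sum_congr rfl hterm, Finset.card_insert_of_notMem ha, pow_succ]
      refine (sum_range_convolution_le hα0 hβ0 _).trans ?_
      refine mul_le_mul hsα hsβ (Finset.sum_nonneg fun p _ => hβ0 p)
        ((Finset.sum_nonneg fun p _ => hα0 p).trans hsα)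

end Moments

/-! ### Gaussian-size even moments under a polynomial moment condition. -/

section EvenMoments

/-- This is where the lower bound on the number of rows is spent. For `α ≤ 1` the first factor is at
most `1` and `4^(-α) ≤ 1/2`. For `α ≥ 1` that factor can be large, but `(2k)^(2α-1) ≤ m` makes its
product with `k/m` at most `1/2`. This is used `q - 1` times, and the one factor left over is beaten
by `4^(-αq)`. -/
theorem rpow_term_le {α m : ℝ} (hα : 1 / 2 ≤ α) {q k : ℕ} (hq : 1 ≤ q) (hqk : q ≤ k)
    (hm : (2 * k : ℝ) ^ max (2 * α - 1) 1 ≤ m) :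
    ((2 * q : ℝ) ^ (2 * α - 2) * (4 : ℝ) ^ (-α) * (k / m)) ^ q ≤ k / m * (1 / 2) ^ q := by
  have hq1 : (1 : ℝ) ≤ q := by exact_mod_cast hq
  have hqk' : (q : ℝ) ≤ k := by exact_mod_cast hqk
  have hN : (1 : ℝ) ≤ 2 * k := by linarith
  have hm2k : 2 * (k : ℝ) ≤ m := by
    refine le_trans ?_ hm
    calc (2 * k : ℝ) = (2 * k) ^ (1 : ℝ) := (Real.rpow_one _).symm
      _ ≤ _ := Real.rpow_le_rpow_of_exponent_le hN (le_max_right _ _)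
  have hm0 : 0 < m := by linarith
  have hkm0 : 0 ≤ (k : ℝ) / m := by positivity
  have hkm : (k : ℝ) / m ≤ 1 / 2 := by
    rw [div_le_div_iff₀ hm0 (by norm_num)]; linarith
  have h4 : (4 : ℝ) ^ (-α) ≤ 1 / 2 := by
    calc (4 : ℝ) ^ (-α) ≤ 4 ^ (-(1 / 2) : ℝ) :=
          Real.rpow_le_rpow_of_exponent_le (by norm_num) (by linarith)
      _ = 1 / 2 := by
          rw [Real.rpow_neg (by norm_num), ← Real.sqrt_eq_rpow, show (4 : ℝ) = 2 ^ 2 by norm_num,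
            Real.sqrt_sq (by norm_num)]; norm_num
  have h40 : 0 < (4 : ℝ) ^ (-α) := by positivity
  have hpow : ∀ x : ℝ, x ^ q = x * x ^ (q - 1) := fun x => by
    rw [← pow_succ']; congr 1; omega
  set x : ℝ := (2 * q : ℝ) ^ (2 * α - 2) with hx
  have hx0 : 0 < x := by positivity
  rcases le_total α 1 with h | h
  · have hx1 : x ≤ 1 := Real.rpow_le_one_of_one_le_of_nonpos (by linarith) (by linarith)
    have h1 : x * 4 ^ (-α) ≤ 1 / 2 := by nlinarith
    rw [mul_pow, mul_comm]
    refine mul_le_mul ?_ (pow_le_pow_left₀ (by positivity) h1 q) (by positivity) hkm0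
    rw [hpow]
    exact mul_le_of_le_one_right hkm0 (pow_le_one₀ hkm0 (by linarith))
  · have hxk : x * (k / m) ≤ 1 / 2 := by
      have h1 : x ≤ (2 * k : ℝ) ^ (2 * α - 2) :=
        Real.rpow_le_rpow (by positivity) (by linarith) (by linarith)
      have h2 : (2 * k : ℝ) ^ (2 * α - 2) * (2 * k) ≤ m := by
        calc (2 * k : ℝ) ^ (2 * α - 2) * (2 * k) = (2 * k : ℝ) ^ (2 * α - 1) := by
              nth_rewrite 2 [← Real.rpow_one (2 * k : ℝ)]
              rw [← Real.rpow_add (by linarith)]; congr 1; ring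
          _ ≤ _ := Real.rpow_le_rpow_of_exponent_le hN (le_max_left _ _)
          _ ≤ m := hm
      have h3 : x * (2 * k) ≤ m :=
        (mul_le_mul_of_nonneg_right h1 (by positivity)).trans h2
      rw [← mul_div_assoc, div_le_div_iff₀ hm0 (by norm_num)]; linarith
    have hx4 : x * ((4 : ℝ) ^ (-α)) ^ q ≤ 1 / 4 := by
      have e1 : ((4 : ℝ) ^ (-α)) ^ q = ((2 : ℝ) ^ q) ^ (-(2 * α)) := by
        rw [← Real.rpow_natCast, ← Real.rpow_natCast, ← Real.rpow_mul (by norm_num),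
          ← Real.rpow_mul (by norm_num), show (4 : ℝ) = 2 ^ (2 : ℝ) by norm_num,
          ← Real.rpow_mul (by norm_num)]
        congr 1; ring
      have e2 : (2 * q : ℝ) ≤ 2 ^ q := by
        have : ∀ r : ℕ, 2 * (r + 1 : ℝ) ≤ 2 ^ (r + 1) := fun r => by
          induction r with
          | zero => norm_num
          | succ r ih => rw [pow_succ]; push_cast; nlinarith [Nat.cast_nonneg (α := ℝ) r]
        obtain ⟨r, rfl⟩ : ∃ r, q = r + 1 := ⟨q - 1, by omega⟩
        exact_mod_cast this r
      have e3 : ((2 : ℝ) ^ q) ^ (-(2 * α)) ≤ (2 * q : ℝ) ^ (-(2 * α)) :=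
        Real.rpow_le_rpow_of_nonpos (by positivity) e2 (by linarith)
      rw [e1]
      calc x * ((2 : ℝ) ^ q) ^ (-(2 * α)) ≤ x * (2 * q : ℝ) ^ (-(2 * α)) :=
            mul_le_mul_of_nonneg_left e3 hx0.le
        _ = (2 * q : ℝ) ^ (-2 : ℝ) := by
            rw [hx, ← Real.rpow_add (by positivity)]; congr 1; ring
        _ ≤ (2 : ℝ) ^ (-2 : ℝ) :=
            Real.rpow_le_rpow_of_nonpos (by norm_num) (by linarith) (by norm_num)
        _ = 1 / 4 := by rw [Real.rpow_neg (by norm_num)]; norm_num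
    have e : (x * (4 : ℝ) ^ (-α) * (k / m)) ^ q
        = (k / m) * ((x * ((4 : ℝ) ^ (-α)) ^ q) * (x * (k / m)) ^ (q - 1)) := by
      rw [show x * (4 : ℝ) ^ (-α) * (k / m) = (4 : ℝ) ^ (-α) * (x * (k / m)) by ring, mul_pow,
        hpow (x * (k / m))]
      ring
    rw [e]
    refine mul_le_mul_of_nonneg_left ?_ hkm0
    calc _ ≤ 1 / 4 * (1 / 2 : ℝ) ^ (q - 1) :=
          mul_le_mul hx4 (pow_le_pow_left₀ (by positivity) hxk _) (by positivity) (by norm_num)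
      _ ≤ _ := by
          rw [hpow]
          have : (0 : ℝ) ≤ (1 / 2) ^ (q - 1) := by positivity
          linarith

theorem sum_range_two_mul_add_one (f : ℕ → ℝ) (k : ℕ) :
    ∑ p ∈ Finset.range (2 * k + 1), f p
      = f 0 + ∑ q ∈ Finset.range k, (f (2 * q + 1) + f (2 * (q + 1))) := by
  induction k with
  | zero => simp
  | succ k ih =>
    rw [show 2 * (k + 1) + 1 = 2 * k + 1 + 1 + 1 by ring, Finset.sum_range_succ,
      Finset.sum_range_succ, ih, Finset.sum_range_succ, show 2 * k + 1 + 1 = 2 * (k + 1) by ring]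
    ring

/-- Even moments of a sum of `m` independent variables with vanishing odd moments and with even
moments controlled by `κ p ^ α`. -/
theorem integral_sum_pow_le {Ω : Type*} [MeasurableSpace Ω] {P : Measure Ω}
    [IsProbabilityMeasure P] {m : ℕ} {Y : Fin m → Ω → ℝ}
    (hind : iIndepFun Y P) (hm : ∀ j, Measurable (Y j)) {k : ℕ} (hk : 1 ≤ k)
    (hL : ∀ j, MemLp (Y j) (2 * k : ℕ) P)
    (hodd : ∀ j p, Odd p → p ≤ 2 * k → ∫ ω, Y j ω ^ p ∂P = 0)
    {κ α : ℝ} (hκ : 0 < κ) (hα : 1 / 2 ≤ α)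
    (heven : ∀ j q, 1 ≤ q → q ≤ k → ∫ ω, Y j ω ^ (2 * q) ∂P ≤ (κ * (2 * q : ℝ) ^ α) ^ (2 * q))
    (hmk : (2 * k : ℝ) ^ max (2 * α - 1) 1 ≤ m) :
    ∫ ω, (∑ i, Y i ω) ^ (2 * k) ∂P
      ≤ (4 * Real.exp 3 * (4 : ℝ) ^ α * κ ^ 2 * k * m) ^ k := by
  have hk1 : (1 : ℝ) ≤ k := by exact_mod_cast hk
  have hm0 : 0 < (m : ℝ) := lt_of_lt_of_le (by positivity) hmk
  -- This scale gives each variable a truncated generating function of at most `1 + k/m`, so the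
  -- product over `m` variables is at most `e^k`. Reading off the coefficient of order `2k` then
  -- costs `(2k)! / z^(2k)`.
  set z : ℝ := √((k / m) / ((4 : ℝ) ^ α * Real.exp 2 * κ ^ 2)) with hzdef
  have hz2 : z ^ 2 = (k / m) / ((4 : ℝ) ^ α * Real.exp 2 * κ ^ 2) :=
    Real.sq_sqrt (by positivity)
  have hz : 0 < z := Real.sqrt_pos.2 (by positivity)
  have hterm : ∀ j q, 1 ≤ q → q ≤ k →
      (∫ ω, Y j ω ^ (2 * q) ∂P) / (2 * q).factorial * z ^ (2 * q) ≤ k / m * (1 / 2) ^ q := by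
    intro j q hq hqk
    have hq0 : (0 : ℝ) < 2 * q := by
      have : (1 : ℝ) ≤ q := by exact_mod_cast hq
      linarith
    refine le_trans ?_ (rpow_term_le hα hq hqk hmk)
    have hfac := Real.pow_div_factorial_le_exp (2 * q : ℝ) hq0.le (2 * q)
    have hf0 : (0 : ℝ) < (2 * q).factorial := by exact_mod_cast Nat.factorial_pos _
    have hinv : 1 / ((2 * q).factorial : ℝ) ≤ (Real.exp 2 / (2 * q : ℝ) ^ 2) ^ q := by
      have e : Real.exp (2 * q : ℝ) = Real.exp 2 ^ q := by
        rw [← Real.exp_nat_mul]; congr 1; ring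
      rw [e, pow_mul, div_le_iff₀ hf0] at hfac
      rw [div_pow, div_le_div_iff₀ hf0 (by positivity)]
      linarith
    calc (∫ ω, Y j ω ^ (2 * q) ∂P) / (2 * q).factorial * z ^ (2 * q)
        ≤ (κ * (2 * q : ℝ) ^ α) ^ (2 * q) / (2 * q).factorial * z ^ (2 * q) := by
          gcongr
          exact heven j q hq hqk
      _ = ((κ * (2 * q : ℝ) ^ α) ^ 2 * z ^ 2) ^ q * (1 / (2 * q).factorial) := by
          generalize κ * (2 * q : ℝ) ^ α = w
          rw [mul_pow, ← pow_mul, ← pow_mul]; ring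
      _ ≤ ((κ * (2 * q : ℝ) ^ α) ^ 2 * z ^ 2) ^ q * (Real.exp 2 / (2 * q : ℝ) ^ 2) ^ q := by
          gcongr
      _ = _ := by
          rw [← mul_pow, hz2]
          congr 1
          have e1 : (2 * q : ℝ) ^ (2 * α - 2) = ((2 * q : ℝ) ^ α) ^ 2 / (2 * q : ℝ) ^ 2 := by
            rw [Real.rpow_sub hq0, ← Real.rpow_natCast ((2 * q : ℝ) ^ α), ← Real.rpow_mul hq0.le]
            norm_num [mul_comm]
          rw [e1, Real.rpow_neg (by norm_num)]
          have := Real.exp_pos 2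
          have : 0 < (4 : ℝ) ^ α := by positivity
          field_simp
  have hG : ∀ j, ∑ p ∈ Finset.range (2 * k + 1),
      (∫ ω, Y j ω ^ p ∂P) / p.factorial * z ^ p ≤ 1 + k / m := by
    intro j
    rw [sum_range_two_mul_add_one]
    have h0 : (∫ ω, Y j ω ^ 0 ∂P) / (0).factorial * z ^ 0 = 1 := by simp
    rw [h0]
    refine add_le_add le_rfl ?_
    calc _ ≤ ∑ q ∈ Finset.range k, (k / m : ℝ) * ((1 / 2) * (1 / 2) ^ q) := by
          refine Finset.sum_le_sum fun q hq => ?_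
          rw [Finset.mem_range] at hq
          rw [hodd j (2 * q + 1) ⟨q, rfl⟩ (by omega), zero_div, zero_mul, zero_add, ← pow_succ']
          exact hterm j (q + 1) (by omega) (by omega)
      _ ≤ k / m * 1 := by
          rw [← Finset.mul_sum, ← Finset.mul_sum]
          refine mul_le_mul_of_nonneg_left ?_ (by positivity)
          rw [geom_sum_eq (by norm_num)]
          have e : ∀ x : ℝ, 1 / 2 * ((x - 1) / (1 / 2 - 1)) = 1 - x := fun x => by norm_num; ring
          rw [e]
          have : (0 : ℝ) ≤ (1 / 2) ^ k := by positivity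
          linarith
      _ = _ := mul_one _
  obtain ⟨hSodd, hS⟩ := sum_moments_le_pow hind hm hL hodd hz.le hG Finset.univ
  have hnn : ∀ p ∈ Finset.range (2 * k + 1),
      0 ≤ (∫ ω, (∑ j, Y j ω) ^ p ∂P) / p.factorial * z ^ p := fun p hp => by
    rw [Finset.mem_range] at hp
    rcases Nat.even_or_odd p with he | ho
    · have : 0 ≤ ∫ ω, (∑ j, Y j ω) ^ p ∂P := integral_nonneg fun ω => he.pow_nonneg _
      positivity
    · rw [hSodd p ho (by omega)]; simp
  have h1 := (Finset.single_le_sum hnn (Finset.mem_range.2 (Nat.lt_succ_self (2 * k)))).trans hS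
  have h2 : (1 + k / m : ℝ) ^ (Finset.univ : Finset (Fin m)).card ≤ Real.exp 1 ^ k := by
    rw [Finset.card_univ, Fintype.card_fin, ← Real.exp_nat_mul, mul_one]
    calc (1 + k / m : ℝ) ^ m ≤ Real.exp (k / m) ^ m := by
          gcongr
          linarith [Real.add_one_le_exp (k / m : ℝ)]
      _ = Real.exp k := by rw [← Real.exp_nat_mul]; congr 1; field_simp
  have hf0 : (0 : ℝ) < (2 * k).factorial := by exact_mod_cast Nat.factorial_pos _
  have hfk : ((2 * k).factorial : ℝ) ≤ ((2 * k : ℝ) ^ 2) ^ k := by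
    rw [← pow_mul]
    exact_mod_cast Nat.factorial_le_pow (2 * k)
  have h3 : (∫ ω, (∑ j, Y j ω) ^ (2 * k) ∂P) * (z ^ 2) ^ k ≤ (Real.exp 1) ^ k * ((2 * k : ℝ) ^ 2) ^ k := by
    have := h1.trans h2
    rw [div_mul_eq_mul_div, div_le_iff₀ hf0] at this
    rw [← pow_mul]
    exact this.trans (by gcongr)
  have hzk : 0 < (z ^ 2) ^ k := by positivity
  rw [← le_div_iff₀ hzk] at h3
  refine h3.trans (le_of_eq ?_)
  rw [← mul_pow, ← div_pow, hz2]
  congr 1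
  have e3 : Real.exp 3 = Real.exp 1 * Real.exp 2 := by rw [← Real.exp_add]; norm_num
  rw [e3]
  have := Real.exp_pos 2
  have : 0 < (4 : ℝ) ^ α := by positivity
  field_simp
  norm_num

end EvenMoments

/-! ### The small-ball estimate and its uniform version. -/

section SmallBall

/-- The ramp equal to `0` on `[-ξ, ξ]` and to `1` off `(-2ξ, 2ξ)`. -/
def ramp (ξ t : ℝ) : ℝ := min 1 (max 0 (|t| / ξ - 1))

theorem ramp_nonneg (ξ t : ℝ) : 0 ≤ ramp ξ t := le_min zero_le_one (le_max_left _ _)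

theorem ramp_le_one (ξ t : ℝ) : ramp ξ t ≤ 1 := min_le_left _ _

theorem abs_ramp_le_one (ξ t : ℝ) : |ramp ξ t| ≤ 1 := by
  rw [abs_of_nonneg (ramp_nonneg ξ t)]; exact ramp_le_one ξ t

theorem mul_ramp_le_abs {ξ : ℝ} (hξ : 0 < ξ) (t : ℝ) : ξ * ramp ξ t ≤ |t| := by
  have : ramp ξ t ≤ |t| / ξ :=
    (min_le_right _ _).trans (max_le (by positivity) (by linarith))
  calc ξ * ramp ξ t ≤ ξ * (|t| / ξ) := mul_le_mul_of_nonneg_left this hξ.le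
    _ = |t| := by field_simp

theorem measurable_ramp (ξ : ℝ) : Measurable (ramp ξ) := by
  unfold ramp; fun_prop

theorem ramp_sub_ramp_le {ξ : ℝ} (hξ : 0 < ξ) (s t : ℝ) :
    ramp ξ s - ramp ξ t ≤ ξ⁻¹ * |s - t| := by
  have h : |ramp ξ s - ramp ξ t| ≤ |(|s| / ξ - 1) - (|t| / ξ - 1)| := by
    unfold ramp
    refine (abs_min_sub_min_le_max _ _ _ _).trans (max_le (by simp) ?_)
    refine (abs_max_sub_max_le_max _ _ _ _).trans (max_le (by simp) le_rfl)
  refine (le_abs_self _).trans (h.trans ?_)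
  rw [show |s| / ξ - 1 - (|t| / ξ - 1) = ξ⁻¹ * (|s| - |t|) by ring, abs_mul,
    abs_of_pos (inv_pos.2 hξ)]
  exact mul_le_mul_of_nonneg_left (abs_abs_sub_abs_le _ _) (inv_pos.2 hξ).le

/-- With `u = l (t² - 4ξ²)` the left side is `2u - u²`, which never exceeds `1` and is nonpositive
when `u ≤ 0`. This quadratic minorant replaces Paley–Zygmund: only second and fourth moments are
needed, and `l` is free to be optimized. -/
theorem indicator_le_ramp {ξ : ℝ} (hξ : 0 < ξ) (t : ℝ) {l : ℝ} (hl : 0 ≤ l) :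
    2 * l * (t ^ 2 - 4 * ξ ^ 2) - l ^ 2 * (t ^ 2 - 4 * ξ ^ 2) ^ 2 ≤ ramp ξ t := by
  rcases le_or_gt (2 * ξ) |t| with h | h
  · have : ramp ξ t = 1 := by
      unfold ramp
      rw [min_eq_left]
      refine le_max_of_le_right ?_
      rw [le_sub_iff_add_le, le_div_iff₀ hξ]; linarith
    rw [this]
    nlinarith [sq_nonneg (l * (t ^ 2 - 4 * ξ ^ 2) - 1)]
  · have h2 : t ^ 2 ≤ 4 * ξ ^ 2 := by
      rw [← sq_abs]; nlinarith [abs_nonneg t]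
    refine le_trans ?_ (ramp_nonneg ξ t)
    nlinarith [mul_nonneg hl (sub_nonneg.2 h2), sq_nonneg (l * (t ^ 2 - 4 * ξ ^ 2))]

/-- A random variable with bounded kurtosis, shifted by a constant, is not concentrated
near `0`. -/
theorem le_integral_ramp_add_const {Ω : Type*} [MeasurableSpace Ω] {P : Measure Ω}
    [IsProbabilityMeasure P] {X : Ω → ℝ} (hX : MemLp X (4 : ℕ) P) (h1 : ∫ ω, X ω ∂P = 0)
    {σ K : ℝ} (hσ : 0 < σ) (h2 : ∫ ω, X ω ^ 2 ∂P = σ) (h4 : ∫ ω, X ω ^ 4 ∂P ≤ 3 * K)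
    (hK : σ ^ 2 ≤ K) (b : ℝ) {ξ : ℝ} (hξ : 0 < ξ) (hξσ : 8 * ξ ^ 2 = σ) :
    σ ^ 2 / (100 * K) ≤ ∫ ω, ramp ξ (X ω + b) ∂P := by
  have hK0 : 0 < K := lt_of_lt_of_le (by positivity) hK
  -- `D` bounds the second moment of `(X + b)² - σ/2`, whose mean is `σ/2 + b²`. The best multiplier
  -- is `l = mean / D`, and it yields `mean² / D`.
  set D := 25 * K + 8 * b ^ 4 with hD
  have hD0 : 0 < D := by positivity
  set l := (σ / 2 + b ^ 2) / D with hl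
  have hl0 : 0 ≤ l := by positivity
  have i2 : Integrable (fun ω => X ω ^ 2) P := integrable_pow_of_memLp hX (by norm_num)
  have i4 : Integrable (fun ω => X ω ^ 4) P := integrable_pow_of_memLp hX (by norm_num)
  have i1 : Integrable X P := hX.integrable (by norm_num)
  have hpt : ∀ ω, 2 * l * (X ω ^ 2 + 2 * b * X ω + (b ^ 2 - σ / 2))
      - l ^ 2 * (8 * X ω ^ 4 + (8 * b ^ 4 + σ ^ 2 / 4)) ≤ ramp ξ (X ω + b) := fun ω => by
    refine le_trans ?_ (indicator_le_ramp hξ (X ω + b) hl0)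
    have e : 4 * ξ ^ 2 = σ / 2 := by linarith
    rw [e]
    have hq : ((X ω + b) ^ 2 - σ / 2) ^ 2 ≤ 8 * X ω ^ 4 + (8 * b ^ 4 + σ ^ 2 / 4) := by
      have e1 : (X ω + b) ^ 4 ≤ 8 * X ω ^ 4 + 8 * b ^ 4 := by
        have a1 : (X ω + b) ^ 2 ≤ 2 * (X ω ^ 2 + b ^ 2) := by nlinarith [sq_nonneg (X ω - b)]
        have a2 : ((X ω + b) ^ 2) ^ 2 ≤ (2 * (X ω ^ 2 + b ^ 2)) ^ 2 :=
          pow_le_pow_left₀ (sq_nonneg _) a1 2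
        nlinarith [sq_nonneg (X ω ^ 2 - b ^ 2)]
      nlinarith [mul_nonneg hσ.le (sq_nonneg (X ω + b))]
    have := mul_le_mul_of_nonneg_left hq (sq_nonneg l)
    have e3 : X ω ^ 2 + 2 * b * X ω + (b ^ 2 - σ / 2) = (X ω + b) ^ 2 - σ / 2 := by ring
    rw [e3]; linarith
  have hA₁ : Integrable (fun ω => X ω ^ 2 + 2 * b * X ω) P := i2.add (i1.const_mul _)
  have hA : Integrable (fun ω => X ω ^ 2 + 2 * b * X ω + (b ^ 2 - σ / 2)) P :=
    hA₁.add (integrable_const _)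
  have hB : Integrable (fun ω => 8 * X ω ^ 4 + (8 * b ^ 4 + σ ^ 2 / 4)) P :=
    (i4.const_mul _).add (integrable_const _)
  have hint : ∫ ω, (2 * l * (X ω ^ 2 + 2 * b * X ω + (b ^ 2 - σ / 2))
      - l ^ 2 * (8 * X ω ^ 4 + (8 * b ^ 4 + σ ^ 2 / 4))) ∂P
      = 2 * l * (σ / 2 + b ^ 2)
        - l ^ 2 * (8 * (∫ ω, X ω ^ 4 ∂P) + (8 * b ^ 4 + σ ^ 2 / 4)) := by
    rw [integral_sub (hA.const_mul _) (hB.const_mul _), integral_const_mul, integral_const_mul,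
      integral_add hA₁ (integrable_const _),
      integral_add i2 (i1.const_mul _), integral_const_mul, h1, h2,
      integral_add (i4.const_mul _) (integrable_const _), integral_const_mul]
    simp only [integral_const, probReal_univ, one_smul]
    ring
  have hmono := integral_mono ((hA.const_mul (2 * l)).sub (hB.const_mul (l ^ 2)))
    (Integrable.of_bound ((measurable_ramp ξ).comp_aemeasurable
      (hX.aestronglyMeasurable.aemeasurable.add_const b)).aestronglyMeasurable 1
      (.of_forall fun ω => abs_ramp_le_one ξ _)) hpt
  refine le_trans ?_ hmono
  simp only [Pi.sub_apply]
  rw [hint]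
  have hDle : 8 * (∫ ω, X ω ^ 4 ∂P) + (8 * b ^ 4 + σ ^ 2 / 4) ≤ D := by
    rw [hD]; nlinarith
  have h5 := mul_le_mul_of_nonneg_left hDle (sq_nonneg l)
  have h6 : l ^ 2 * D = l * (σ / 2 + b ^ 2) := by rw [hl]; field_simp
  -- Both `(σ/2 + b²)²` and `D` grow like `b⁴`, so the bound survives arbitrary shifts; `σ² ≤ K`
  -- makes the constant independent of `b`.
  have h7 : σ ^ 2 / (100 * K) ≤ l * (σ / 2 + b ^ 2) := by
    rw [hl, div_mul_eq_mul_div, div_le_div_iff₀ (by positivity) hD0, hD]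
    have := mul_le_mul_of_nonneg_right hK (show 0 ≤ b ^ 4 by positivity)
    have : 0 ≤ σ * b ^ 2 * K := by positivity
    nlinarith [show 0 ≤ b ^ 4 * K by positivity]
  linarith

variable {E : Type*} [MeasurableSpace E] {V : Type*} [Finite V] [Nonempty V]

/-- The largest deviation of the ramp sums from their expectations. -/
def rampDeviation {m : ℕ} (μ : Fin m → Measure E) (f : V → E → ℝ) (ξ : ℝ) (x : Fin m → E) : ℝ :=
  ⨆ v, ∑ i, ((∫ y, ramp ξ (f v y) ∂μ i) - ramp ξ (f v (x i)))

/-- The means add up to at least `m p`. The expected deviation and the McDiarmid fluctuation are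
each allowed `m p / 4`, which leaves `m p / 2`; the exponent is `(m p / 4)² / (2m)`. -/
theorem measure_ramp_sum_le {m : ℕ} (μ : Fin m → Measure E) [∀ i, IsProbabilityMeasure (μ i)]
    {f : V → E → ℝ} (hf : ∀ v, Measurable (f v)) {ξ p : ℝ} (hp : 0 ≤ p)
    (hsmall : ∀ i v, p ≤ ∫ y, ramp ξ (f v y) ∂μ i)
    (hE : ∫ x, rampDeviation μ f ξ x ∂Measure.pi μ ≤ m * p / 4) :
    (Measure.pi μ).real {x | ∃ v, ∑ i, ramp ξ (f v (x i)) ≤ m * p / 2}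
      ≤ Real.exp (-(p ^ 2 * m / 32)) := by
  have hI0 : ∀ i v, 0 ≤ ∫ y, ramp ξ (f v y) ∂μ i := fun i v =>
    integral_nonneg fun y => ramp_nonneg _ _
  have hI1 : ∀ i v, ∫ y, ramp ξ (f v y) ∂μ i ≤ 1 := fun i v => by
    have := norm_integral_le_of_norm_le_const (μ := μ i) (C := 1)
      (f := fun y => ramp ξ (f v y)) (.of_forall fun y => abs_ramp_le_one ξ _)
    simpa using (le_abs_self _).trans this
  have hmeas : Measurable (rampDeviation μ f ξ) := by
    unfold rampDeviation
    refine Measurable.iSup fun v => Finset.measurable_sum _ fun i _ => ?_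
    exact measurable_const.sub ((measurable_ramp ξ).comp ((hf v).comp (measurable_pi_apply i)))
  have hbd : ∀ x, |rampDeviation μ f ξ x| ≤ m := fun x => by
    obtain ⟨v, hv⟩ := exists_eq_ciSup_of_finite
      (f := fun v => ∑ i, ((∫ y, ramp ξ (f v y) ∂μ i) - ramp ξ (f v (x i))))
    rw [rampDeviation, ← hv]
    refine (Finset.abs_sum_le_sum_abs _ _).trans ?_
    calc _ ≤ ∑ i : Fin m, (1 : ℝ) := Finset.sum_le_sum fun i _ => by
            rw [abs_le]
            have := hI0 i v; have := hI1 i v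
            have := ramp_nonneg ξ (f v (x i)); have := ramp_le_one ξ (f v (x i))
            constructor <;> linarith
      _ = m := by simp
  have hdiff : ∀ x i y,
      |rampDeviation μ f ξ (Function.update x i y) - rampDeviation μ f ξ x| ≤ 1 := by
    intro x i y
    refine abs_iSup_sub_iSup_le fun v => ?_
    rw [← Finset.sum_sub_distrib, Finset.sum_eq_single i]
    · rw [Function.update_self, abs_le]
      have := ramp_nonneg ξ (f v (x i)); have := ramp_le_one ξ (f v (x i))
      have := ramp_nonneg ξ (f v y); have := ramp_le_one ξ (f v y)
      constructor <;> linarith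
    · intro j _ hj
      rw [Function.update_of_ne hj]; ring
    · simp
  have hmc := measure_ge_le_of_bounded_differences μ hmeas hbd hdiff
    (t := m * p / 4) (by positivity)
  refine (measureReal_mono ?_).trans (hmc.trans (le_of_eq ?_))
  · rintro x ⟨v, hv⟩
    have h1 := le_iSup_finite
      (fun v => ∑ i, ((∫ y, ramp ξ (f v y) ∂μ i) - ramp ξ (f v (x i)))) v
    have h2 : (m : ℝ) * p ≤ ∑ i : Fin m, ∫ y, ramp ξ (f v y) ∂μ i := by
      calc (m : ℝ) * p = ∑ i : Fin m, p := by simp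
        _ ≤ _ := Finset.sum_le_sum fun i _ => hsmall i v
    rw [Finset.sum_sub_distrib] at h1
    change _ ≤ rampDeviation μ f ξ x at h1
    change _ ≤ rampDeviation μ f ξ x
    linarith
  · congr 1
    rcases eq_or_ne m 0 with rfl | hm
    · simp
    · have : (m : ℝ) ≠ 0 := by exact_mod_cast hm
      field_simp
      ring

/-- Symmetrization and contraction are applied row by row, the ramp being `ξ⁻¹`-Lipschitz. -/
theorem integral_rampDeviation_le {m : ℕ} (μ : Fin m → Measure E)
    [∀ i, IsProbabilityMeasure (μ i)] {f : V → E → ℝ} (hfm : ∀ v, Measurable (f v))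
    (hf : ∀ i v, Integrable (f v) (μ i)) {ξ : ℝ} (hξ : 0 < ξ) :
    ∫ x, rampDeviation μ f ξ x ∂Measure.pi μ
      ≤ ∫ y, ⨆ v, ∑ i, 2 * ξ⁻¹ * ((y i).2 * f v (y i).1)
          ∂Measure.pi fun i => (μ i).prod rademacher := by
  have := integral_iSup_add_sum_le μ (fun i => (μ i).prod rademacher)
    (g := fun i v x => (∫ y, ramp ξ (f v y) ∂μ i) - ramp ξ (f v x))
    (g' := fun i v y => 2 * ξ⁻¹ * (y.2 * f v y.1))
    (fun i v => measurable_const.sub ((measurable_ramp ξ).comp (hfm v)))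
    (fun i v => by fun_prop)
    (fun i v => (integrable_const _).sub (Integrable.of_bound
      ((measurable_ramp ξ).comp (hfm v)).aestronglyMeasurable 1
      (.of_forall fun x => abs_ramp_le_one ξ _)))
    (fun i v => integrable_snd_mul_fst (hf i v) _)
    (fun i c => integral_iSup_sub_le_rademacher (μ i) hfm (hf i) (measurable_ramp ξ)
      (abs_ramp_le_one ξ) (ramp_sub_ramp_le hξ) c) (fun _ => 0)
  simpa [rampDeviation] using this

end SmallBall

/-! ### Linear functionals on the cone and block norms. -/

section Cone

variable {n : ℕ}

/-- The unit vectors at which the `ℓ₂-RNSP` inequality is not implied by its `ℓ₁` term. -/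
def unitCone (n s : ℕ) (ρ : ℝ) : Set (Fin n → ℝ) :=
  {v | ∑ j, v j ^ 2 = 1 ∧
    ∃ S : Finset (Fin n), S.card ≤ s ∧ ρ / √(s : ℝ) * ∑ j ∈ Sᶜ, |v j| ≤ √(∑ j ∈ S, v j ^ 2)}

/-- Split the coordinates into the set `S₀` witnessing membership in the cone, those where `h` is
large, and the rest. Cauchy–Schwarz gives `b` on each of the first two. On the rest `|h j| ≤ b/√s`,
and the cone condition bounds the `ℓ₁` norm of `v` off `S₀` by `√s/ρ`. -/
theorem dotProduct_le_of_mem_unitCone {s : ℕ} (hs : 1 ≤ s) {ρ : ℝ} (hρ : 0 < ρ) (hρ1 : ρ ≤ 1)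
    {v : Fin n → ℝ} (hv : v ∈ unitCone n s ρ) {h : Fin n → ℝ} {b : ℝ} (hb : 0 ≤ b)
    (H : ∀ S : Finset (Fin n), S.card ≤ s → ∑ j ∈ S, h j ^ 2 ≤ b ^ 2) :
    ∑ j, h j * v j ≤ 3 / ρ * b := by
  classical
  obtain ⟨hv1, S₀, hS₀, hcone⟩ := hv
  have hs0 : (0 : ℝ) < s := by exact_mod_cast hs
  have hrs : 0 < √(s : ℝ) := Real.sqrt_pos.2 hs0
  have hvS : ∀ S : Finset (Fin n), ∑ j ∈ S, v j ^ 2 ≤ 1 := fun S =>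
    hv1 ▸ Finset.sum_le_sum_of_subset_of_nonneg (Finset.subset_univ S) fun j _ _ => sq_nonneg _
  have hCS : ∀ S : Finset (Fin n), S.card ≤ s → ∑ j ∈ S, |h j * v j| ≤ b := fun S hS => by
    have h1 := Finset.sum_mul_sq_le_sq_mul_sq S (fun j => |h j|) (fun j => |v j|)
    simp only [sq_abs] at h1
    have h2 : (∑ j ∈ S, h j ^ 2) * ∑ j ∈ S, v j ^ 2 ≤ b ^ 2 * 1 :=
      mul_le_mul (H S hS) (hvS S) (Finset.sum_nonneg fun j _ => sq_nonneg _) (sq_nonneg b)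
    simp only [abs_mul]
    exact (le_abs_self _).trans (abs_le_of_sq_le_sq (by linarith) hb)
  -- At the threshold `b/√s` at most `s` coordinates are large; otherwise `s` of them would already
  -- exceed the block bound `b²`.
  set S₁ : Finset (Fin n) := Finset.univ.filter fun j => b / √(s : ℝ) < |h j| with hS₁
  have hcard : S₁.card ≤ s := by
    by_contra hlt
    push Not at hlt
    obtain ⟨T, hT, hTc⟩ := Finset.exists_subset_card_eq hlt.le
    have h1 : ∑ j ∈ T, b ^ 2 / s < ∑ j ∈ T, h j ^ 2 := by
      refine Finset.sum_lt_sum_of_nonempty (Finset.card_pos.1 (by omega)) fun j hj => ?_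
      have h2 := (Finset.mem_filter.1 (hT hj)).2
      have h3 : (b / √(s : ℝ)) ^ 2 < |h j| ^ 2 := pow_lt_pow_left₀ h2 (by positivity) (by norm_num)
      rwa [div_pow, Real.sq_sqrt hs0.le, sq_abs] at h3
    rw [Finset.sum_const, hTc, nsmul_eq_mul, mul_div_cancel₀ _ hs0.ne'] at h1
    exact absurd (H T hTc.le) (not_le.2 h1)
  have hpt : ∀ j, h j * v j ≤ (if j ∈ S₀ then |h j * v j| else 0)
      + (if j ∈ S₁ then |h j * v j| else 0) + (if j ∈ S₀ᶜ then b / √(s : ℝ) * |v j| else 0) := by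
    intro j
    have hnn : 0 ≤ b / √(s : ℝ) * |v j| := by positivity
    have habs := abs_nonneg (h j * v j)
    have hle := le_abs_self (h j * v j)
    by_cases h0 : j ∈ S₀
    · rw [if_pos h0]
      split_ifs <;> linarith
    · rw [if_neg h0, if_pos (Finset.mem_compl.2 h0)]
      by_cases h1 : j ∈ S₁
      · rw [if_pos h1]; linarith
      · rw [if_neg h1]
        have h2 : |h j| ≤ b / √(s : ℝ) := by
          by_contra h3
          exact h1 (Finset.mem_filter.2 ⟨Finset.mem_univ _, not_le.1 h3⟩)
        have := mul_le_mul_of_nonneg_right h2 (abs_nonneg (v j))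
        rw [abs_mul] at hle; linarith
  have hsum := Finset.sum_le_sum fun j (_ : j ∈ Finset.univ) => hpt j
  rw [Finset.sum_add_distrib, Finset.sum_add_distrib, Finset.sum_ite_mem, Finset.sum_ite_mem,
    Finset.sum_ite_mem, Finset.univ_inter, Finset.univ_inter, Finset.univ_inter,
    ← Finset.mul_sum] at hsum
  have hl1 : b / √(s : ℝ) * ∑ j ∈ S₀ᶜ, |v j| ≤ b / ρ := by
    have h1 : ρ / √(s : ℝ) * ∑ j ∈ S₀ᶜ, |v j| ≤ 1 :=
      hcone.trans (Real.sqrt_le_one.2 (hvS S₀))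
    calc b / √(s : ℝ) * ∑ j ∈ S₀ᶜ, |v j| = b / ρ * (ρ / √(s : ℝ) * ∑ j ∈ S₀ᶜ, |v j|) := by
          field_simp
      _ ≤ b / ρ * 1 := mul_le_mul_of_nonneg_left h1 (by positivity)
      _ = _ := mul_one _
  have hbρ : b ≤ b / ρ := le_div_self hb hρ hρ1
  have := hCS S₀ hS₀
  have := hCS S₁ hcard
  have e : 3 / ρ * b = b / ρ + b / ρ + b / ρ := by ring
  rw [e]; linarith

theorem sum_sq_pow_le {s k : ℕ} (hk : 1 ≤ k) (h : Fin n → ℝ) {S : Finset (Fin n)}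
    (hS : S.card ≤ s) :
    (∑ j ∈ S, h j ^ 2) ^ k ≤ (s : ℝ) ^ (k - 1) * ∑ j, h j ^ (2 * k) := by
  obtain ⟨r, rfl⟩ : ∃ r, k = r + 1 := ⟨k - 1, by omega⟩
  have hnn : ∀ j ∈ (Finset.univ : Finset (Fin n)), 0 ≤ h j ^ (2 * (r + 1)) := fun j _ =>
    (even_two_mul _).pow_nonneg _
  rcases S.eq_empty_or_nonempty with rfl | hne
  · simp only [Finset.sum_empty, ne_eq, Nat.add_eq_zero_iff, one_ne_zero, and_false,
      not_false_eq_true, zero_pow]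
    exact mul_nonneg (by positivity) (Finset.sum_nonneg hnn)
  · have h1 := pow_sum_div_card_le_sum_pow (s := S) (f := fun j => h j ^ 2)
      (fun j _ => sq_nonneg _) r
    have hc : (0 : ℝ) < (S.card : ℝ) ^ r := by
      have : (0 : ℝ) < S.card := by exact_mod_cast hne.card_pos
      positivity
    rw [div_le_iff₀ hc] at h1
    simp only [← pow_mul] at h1
    refine h1.trans ?_
    rw [mul_comm, Nat.add_sub_cancel]
    refine mul_le_mul (pow_le_pow_left₀ (by positivity) (by exact_mod_cast hS) _)
      (Finset.sum_le_sum_of_subset_of_nonneg (Finset.subset_univ S) fun j hj _ => hnn j hj)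
      (Finset.sum_nonneg fun j _ => (even_two_mul _).pow_nonneg _) (by positivity)

/-- For `y ≥ 0` and `a > 0`, `y ≤ a + y^(2k) / a^(2k-1)`. This linearizes the `2k`-th root, so
expectations can be taken directly from moments. -/
theorem sum_sq_le_sq_add {s k : ℕ} (hk : 1 ≤ k) (h : Fin n → ℝ) {S : Finset (Fin n)}
    (hS : S.card ≤ s) {a : ℝ} (ha : 0 < a) :
    ∑ j ∈ S, h j ^ 2
      ≤ (a + (s : ℝ) ^ (k - 1) * (∑ j, h j ^ (2 * k)) / a ^ (2 * k - 1)) ^ 2 := by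
  have h1 := sum_sq_pow_le hk h hS
  set Q := (s : ℝ) ^ (k - 1) * ∑ j, h j ^ (2 * k)
  have hx0 : 0 ≤ ∑ j ∈ S, h j ^ 2 := Finset.sum_nonneg fun j _ => sq_nonneg _
  set y := √(∑ j ∈ S, h j ^ 2) with hy
  have hy2 : y ^ 2 = ∑ j ∈ S, h j ^ 2 := Real.sq_sqrt hx0
  have hy0 : 0 ≤ y := Real.sqrt_nonneg _
  rw [← hy2, ← pow_mul] at h1
  rw [← hy2]
  have hQ : 0 ≤ Q := le_trans (by positivity) h1
  refine pow_le_pow_left₀ hy0 ?_ 2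
  rcases le_total y a with h | h
  · have : 0 ≤ Q / a ^ (2 * k - 1) := by positivity
    linarith
  · have : y ≤ Q / a ^ (2 * k - 1) := by
      rw [le_div_iff₀ (by positivity)]
      refine le_trans ?_ h1
      calc y * a ^ (2 * k - 1) ≤ y * y ^ (2 * k - 1) := by gcongr
        _ = y ^ (2 * k) := by rw [← pow_succ']; congr 1; omega
    linarith

/-- Expected size of the largest `s`-coordinate block of a random vector with controlled
`2k`-th moments. -/
theorem exists_block_bound {Ω : Type*} [MeasurableSpace Ω] {P : Measure Ω}
    [IsProbabilityMeasure P] {h : Fin n → Ω → ℝ} {s k : ℕ} (hs : 1 ≤ s) (hk : 1 ≤ k) {T : ℝ}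
    (hT : 0 < T) (hint : ∀ j, Integrable (fun ω => h j ω ^ (2 * k)) P)
    (hmom : ∀ j, ∫ ω, h j ω ^ (2 * k) ∂P ≤ T ^ k) (hn : (n : ℝ) ≤ s * Real.exp (4 * k)) :
    ∃ b : Ω → ℝ, Integrable b P ∧ (∀ ω, 0 ≤ b ω) ∧
      (∀ ω (S : Finset (Fin n)), S.card ≤ s → ∑ j ∈ S, h j ω ^ 2 ≤ b ω ^ 2) ∧
      ∫ ω, b ω ∂P ≤ 2 * √(s * Real.exp 4 * T) := by
  have hs0 : (0 : ℝ) < s := by exact_mod_cast hs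
  set a := √(s * Real.exp 4 * T) with ha
  have ha2 : a ^ 2 = s * Real.exp 4 * T := Real.sq_sqrt (by positivity)
  have ha0 : 0 < a := Real.sqrt_pos.2 (by positivity)
  have hsum : Integrable (fun ω => ∑ j, h j ω ^ (2 * k)) P :=
    integrable_finsetSum _ fun j _ => hint j
  refine ⟨fun ω => a + (s : ℝ) ^ (k - 1) * (∑ j, h j ω ^ (2 * k)) / a ^ (2 * k - 1), ?_, ?_,
    fun ω S hS => sum_sq_le_sq_add hk (fun j => h j ω) hS ha0, ?_⟩
  · exact (integrable_const _).add ((hsum.const_mul _).div_const _)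
  · intro ω
    have : 0 ≤ ∑ j, h j ω ^ (2 * k) := Finset.sum_nonneg fun j _ => (even_two_mul _).pow_nonneg _
    positivity
  · rw [integral_add (integrable_const _) ((hsum.const_mul _).div_const _), integral_div,
      integral_const_mul, integral_finsetSum _ fun j _ => hint j]
    simp only [integral_const, probReal_univ, one_smul]
    have h1 : ∑ j, ∫ ω, h j ω ^ (2 * k) ∂P ≤ n * T ^ k := by
      calc _ ≤ ∑ j : Fin n, T ^ k := Finset.sum_le_sum fun j _ => hmom j
        _ = _ := by simp
    -- The union over `n` coordinates costs `n ≤ s e^(4k)`, which the factor `e⁴` in `a²` absorbs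
    -- after raising to the power `k`.
    have h2 : (s : ℝ) ^ (k - 1) * ∑ j, ∫ ω, h j ω ^ (2 * k) ∂P ≤ a ^ (2 * k) := by
      calc _ ≤ (s : ℝ) ^ (k - 1) * ((s * Real.exp (4 * k)) * T ^ k) := by
            gcongr
            exact h1.trans (by gcongr)
        _ = ((s : ℝ) ^ (k - 1) * s) * Real.exp (4 * k) * T ^ k := by ring
        _ = a ^ (2 * k) := by
            rw [← pow_succ, Nat.sub_add_cancel hk, pow_mul, ha2, mul_pow, mul_pow,
              ← Real.exp_nat_mul, mul_comm (4 : ℝ)]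
    have h3 : (s : ℝ) ^ (k - 1) * (∑ j, ∫ ω, h j ω ^ (2 * k) ∂P) / a ^ (2 * k - 1) ≤ a := by
      rw [div_le_iff₀ (by positivity), ← pow_succ', Nat.sub_add_cancel (by omega)]
      exact h2
    linarith

/-- The order must be large enough for the union over coordinates, yet `2k` must stay within the
range of available moments; `⌊x/2⌋` does both once `x ≥ 2`. -/
theorem exists_moment_order (x : ℝ) :
    ∃ k : ℕ, 1 ≤ k ∧ (2 * k : ℝ) ≤ max 2 x ∧ x ≤ 4 * k := by
  rcases lt_or_ge x 2 with h | h
  · exact ⟨1, le_rfl, by simp, by norm_num; linarith⟩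
  · have h1 : 1 ≤ ⌊x / 2⌋₊ := Nat.le_floor (by push_cast; linarith)
    have h1' : (1 : ℝ) ≤ (⌊x / 2⌋₊ : ℝ) := by exact_mod_cast h1
    refine ⟨⌊x / 2⌋₊, h1, le_max_of_le_right ?_, ?_⟩
    · have := Nat.floor_le (show 0 ≤ x / 2 by linarith); linarith
    · have := Nat.lt_floor_add_one (x / 2); linarith

end Cone

/-! ### The Rademacher width of the cone. -/

section Width

variable {E : Type*} [MeasurableSpace E]

theorem ae_abs_rademacher : ∀ᵐ e ∂rademacher, |e| = 1 := by
  rw [rademacher, ae_add_measure_iff]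
  constructor <;>
  · refine Measure.ae_smul_measure ?_ _
    rw [ae_dirac_eq]
    simp

theorem ae_forall_abs_snd {m : ℕ} (μ : Fin m → Measure E) [∀ i, IsProbabilityMeasure (μ i)] :
    ∀ᵐ y ∂Measure.pi fun i => (μ i).prod rademacher, ∀ i, |(y i).2| = 1 := by
  rw [ae_all_iff]
  intro i
  have h1 : ∀ᵐ z ∂(μ i).prod rademacher, |z.2| = 1 :=
    (measurePreserving_snd (μ := μ i) (ν := rademacher)).quasiMeasurePreserving.ae
      ae_abs_rademacher
  exact (measurePreserving_eval (fun i => (μ i).prod rademacher) i).quasiMeasurePreserving.ae h1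

/-- The sign factor kills odd moments and leaves even ones unchanged, which is what the generating
function argument needs. -/
theorem integral_pi_eval_prod {m : ℕ} (μ : Fin m → Measure E) [∀ i, IsProbabilityMeasure (μ i)]
    (i : Fin m) {g : E → ℝ} (hg : Measurable g) (p : ℕ) :
    ∫ y, ((y i).2 * g (y i).1) ^ p ∂Measure.pi (fun i => (μ i).prod rademacher)
      = (∫ x, g x ^ p ∂μ i) * ((1 + (-1) ^ p) / 2) := by
  have h := measurePreserving_eval (fun i => (μ i).prod rademacher) i
  have h1 : ∫ y, ((y i).2 * g (y i).1) ^ p ∂Measure.pi (fun i => (μ i).prod rademacher)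
      = ∫ z, (z.2 * g z.1) ^ p ∂(μ i).prod rademacher := by
    rw [← h.map_eq, integral_map h.measurable.aemeasurable
      (Measurable.aestronglyMeasurable (by fun_prop))]
  rw [h1]
  simp only [mul_pow, mul_comm (_ ^ p : ℝ) (g _ ^ p)]
  rw [integral_prod_mul (fun x => g x ^ p) (fun e : ℝ => e ^ p), integral_rademacher]
  simp

theorem memLp_sum_rademacher {m : ℕ} (μ : Fin m → Measure E) [∀ i, IsProbabilityMeasure (μ i)]
    {g : E → ℝ} (i : Fin m) (hgm : Measurable g) {p : ENNReal} (hg : MemLp g p (μ i)) :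
    MemLp (fun y : Fin m → E × ℝ => (y i).2 * g (y i).1) p
      (Measure.pi fun i => (μ i).prod rademacher) := by
  have h1 : MemLp (fun y : Fin m → E × ℝ => g (y i).1) p
      (Measure.pi fun i => (μ i).prod rademacher) :=
    (hg.comp_measurePreserving measurePreserving_fst).comp_measurePreserving
      (measurePreserving_eval (fun i => (μ i).prod rademacher) i)
  refine h1.of_le (Measurable.aestronglyMeasurable (by fun_prop)) ?_
  filter_upwards [ae_forall_abs_snd μ] with y hy
  rw [norm_mul, Real.norm_eq_abs, hy i, one_mul]

/-- Even moments of a Rademacher-weighted sum of independent variables. -/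
theorem integral_rademacher_sum_pow_le {m : ℕ} (μ : Fin m → Measure E)
    [∀ i, IsProbabilityMeasure (μ i)] {g : Fin m → E → ℝ} (hgm : ∀ i, Measurable (g i))
    {k : ℕ} (hk : 1 ≤ k) (hL : ∀ i, MemLp (g i) (2 * k : ℕ) (μ i))
    {κ α : ℝ} (hκ : 0 < κ) (hα : 1 / 2 ≤ α)
    (heven : ∀ i q, 1 ≤ q → q ≤ k → ∫ x, g i x ^ (2 * q) ∂μ i ≤ (κ * (2 * q : ℝ) ^ α) ^ (2 * q))
    (hmk : (2 * k : ℝ) ^ max (2 * α - 1) 1 ≤ m) :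
    Integrable (fun y : Fin m → E × ℝ => (∑ i, (y i).2 * g i (y i).1) ^ (2 * k))
      (Measure.pi fun i => (μ i).prod rademacher) ∧
    ∫ y, (∑ i, (y i).2 * g i (y i).1) ^ (2 * k) ∂Measure.pi (fun i => (μ i).prod rademacher)
      ≤ (4 * Real.exp 3 * (4 : ℝ) ^ α * κ ^ 2 * k * m) ^ k := by
  have hY : ∀ i, MemLp (fun y : Fin m → E × ℝ => (y i).2 * g i (y i).1) (2 * k : ℕ)
      (Measure.pi fun i => (μ i).prod rademacher) := fun i =>
    memLp_sum_rademacher μ i (hgm i) (hL i)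
  refine ⟨integrable_pow_of_memLp (memLp_finsetSum _ fun i _ => hY i) le_rfl, ?_⟩
  refine integral_sum_pow_le (Y := fun i (y : Fin m → E × ℝ) => (y i).2 * g i (y i).1)
    (iIndepFun_pi (μ := fun i => (μ i).prod rademacher) (X := fun i z => z.2 * g i z.1)
      fun i => Measurable.aemeasurable (by fun_prop))
    (fun i => by fun_prop) hk hY ?_ hκ hα ?_ hmk
  · intro i p hp _
    rw [integral_pi_eval_prod μ i (hgm i), hp.neg_one_pow]; simp
  · intro i q hq hqk
    rw [integral_pi_eval_prod μ i (hgm i), (even_two_mul q).neg_one_pow]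
    simpa using heven i q hq hqk

variable {n : ℕ}

theorem sum_le_localFrobenius {m : ℕ} (M : Matrix (Fin m) (Fin n) ℝ) {s : ℕ} (hsn : s ≤ n)
    {S : Finset (Fin n)} (hS : S.card ≤ s) :
    ∑ j ∈ S, ∑ i, M i j ^ 2 ≤ localFrobenius M s ^ 2 := by
  obtain ⟨T, hST, hT⟩ := Finset.exists_superset_card_eq hS (by simpa using hsn)
  have h1 : √(∑ j ∈ T, ∑ i, M i j ^ 2) ≤ localFrobenius M s :=
    le_iSup_finite (fun S : {S : Finset (Fin n) // S.card = s} =>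
      √(∑ j ∈ S.1, ∑ i, M i j ^ 2)) ⟨T, hT⟩
  calc _ ≤ ∑ j ∈ T, ∑ i, M i j ^ 2 := Finset.sum_le_sum_of_subset_of_nonneg hST
          fun j _ _ => Finset.sum_nonneg fun i _ => sq_nonneg _
    _ = √(∑ j ∈ T, ∑ i, M i j ^ 2) ^ 2 := (Real.sq_sqrt (Finset.sum_nonneg fun j _ =>
          Finset.sum_nonneg fun i _ => sq_nonneg _)).symm
    _ ≤ _ := pow_le_pow_left₀ (Real.sqrt_nonneg _) h1 2

theorem localFrobenius_nonneg {m : ℕ} (M : Matrix (Fin m) (Fin n) ℝ) (s : ℕ) :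
    0 ≤ localFrobenius M s := Real.iSup_nonneg fun _ => Real.sqrt_nonneg _

theorem abs_le_maxEntry {m : ℕ} (M : Matrix (Fin m) (Fin n) ℝ) (i : Fin m) (j : Fin n) :
    |M i j| ≤ maxEntry M :=
  le_iSup_finite (fun q : Fin m × Fin n => |M q.1 q.2|) (i, j)

theorem maxEntry_nonneg {m : ℕ} (M : Matrix (Fin m) (Fin n) ℝ) : 0 ≤ maxEntry M :=
  Real.iSup_nonneg fun _ => abs_nonneg _

/-- Block bound for Rademacher-weighted sums of the rows of a fixed matrix. -/
theorem exists_block_bound_mean {m : ℕ} (μ : Fin m → Measure E)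
    [∀ i, IsProbabilityMeasure (μ i)] (M : Matrix (Fin m) (Fin n) ℝ) {s : ℕ} (hs : 1 ≤ s)
    (hsn : s ≤ n) (hn : 2 ≤ n) (hm2 : 2 ≤ m)
    (hm : Real.log (Real.exp 1 * n) ≤ m) :
    ∃ b : (Fin m → E × ℝ) → ℝ, Integrable b (Measure.pi fun i => (μ i).prod rademacher) ∧
      (∀ y, 0 ≤ b y) ∧
      (∀ᵐ y ∂Measure.pi fun i => (μ i).prod rademacher, ∀ S : Finset (Fin n), S.card ≤ s →
        ∑ j ∈ S, (∑ i, (y i).2 * M i j) ^ 2 ≤ b y ^ 2) ∧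
      ∫ y, b y ∂Measure.pi (fun i => (μ i).prod rademacher) ≤
        8 * Real.exp 4 * √m * min (localFrobenius M s) (√((s : ℝ) * Real.log n) * maxEntry M) := by
  have hm0 : (0 : ℝ) < m := by
    have : (2 : ℝ) ≤ m := by exact_mod_cast hm2
    linarith
  have hs0 : (0 : ℝ) < s := by exact_mod_cast hs
  have hn2 : (2 : ℝ) ≤ n := by exact_mod_cast hn
  have hlog2 : Real.log 2 ≤ Real.log n := Real.log_le_log (by norm_num) hn2
  have hl2 := Real.log_two_gt_d9
  have he1 : 1 ≤ Real.exp 4 := Real.one_le_exp (by norm_num)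
  -- The Frobenius bound is deterministic: Cauchy–Schwarz over rows with signs of modulus one. The
  -- other bound controls the largest single coordinate of the Rademacher sum and multiplies by
  -- `√s`.
  rcases le_total (localFrobenius M s) (√((s : ℝ) * Real.log n) * maxEntry M) with hmin | hmin
  · rw [min_eq_left hmin]
    have hF := localFrobenius_nonneg M s
    refine ⟨fun _ => √m * localFrobenius M s, integrable_const _, fun _ => by positivity, ?_, ?_⟩
    · filter_upwards [ae_forall_abs_snd μ] with y hy S hS
      rw [mul_pow, Real.sq_sqrt hm0.le]
      refine le_trans ?_ (mul_le_mul_of_nonneg_left (sum_le_localFrobenius M hsn hS) hm0.le)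
      rw [Finset.mul_sum]
      refine Finset.sum_le_sum fun j _ => ?_
      have := Finset.sum_mul_sq_le_sq_mul_sq Finset.univ (fun i => (y i).2) (fun i => M i j)
      refine this.trans (le_of_eq ?_)
      congr 1
      calc ∑ i, (y i).2 ^ 2 = ∑ i : Fin m, (1 : ℝ) :=
            Finset.sum_congr rfl fun i _ => by rw [← sq_abs, hy i, one_pow]
        _ = m := by simp
    · simp only [integral_const, probReal_univ, one_smul]
      have : 0 ≤ √(m : ℝ) * localFrobenius M s := by positivity
      nlinarith
  · rw [min_eq_right hmin]
    rcases (maxEntry_nonneg M).eq_or_lt with h0 | hpos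
    · have hM : ∀ i j, M i j = 0 := fun i j =>
        abs_nonpos_iff.1 ((abs_le_maxEntry M i j).trans h0.symm.le)
      refine ⟨fun _ => 0, integrable_const _, fun _ => le_rfl, .of_forall fun y S _ => ?_, ?_⟩
      · simp [hM]
      · simp [← h0]
    · obtain ⟨k, hk, hk2, hk4⟩ := exists_moment_order (Real.log (Real.exp 1 * n))
      have hlogen : Real.log (Real.exp 1 * n) = 1 + Real.log n := by
        rw [Real.log_mul (Real.exp_pos 1).ne' (by linarith), Real.log_exp]
      have hkm : (2 * k : ℝ) ≤ m :=
        hk2.trans (max_le (by exact_mod_cast hm2) hm)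
      have hklog : (k : ℝ) ≤ 2 * Real.log n := by
        rcases le_max_iff.1 hk2 with h | h
        · linarith
        · rw [hlogen] at h; linarith
      have hmom := fun j => integral_rademacher_sum_pow_le μ (g := fun i _ => M i j)
        (fun i => measurable_const) hk (fun i => memLp_const _) hpos le_rfl
        (fun i q hq _ => by
          simp only [integral_const, probReal_univ, one_smul]
          have hq1 : (1 : ℝ) ≤ q := by exact_mod_cast hq
          rw [← (even_two_mul q).pow_abs]
          refine pow_le_pow_left₀ (abs_nonneg _) ((abs_le_maxEntry M i j).trans ?_) _
          exact le_mul_of_one_le_right hpos.le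
            (Real.one_le_rpow (by linarith) (by norm_num)))
        (by
          have : max (2 * (1 / 2 : ℝ) - 1) 1 = 1 := by norm_num
          rw [this, Real.rpow_one]; exact hkm)
      -- Blocks of size one with bounded (`α = 1/2`) terms: the moment order is comparable to
      -- `log(en)`, and `n ≥ 2` allows `k ≤ 2 log n`.
      obtain ⟨b, hbi, hb0, hb, hbint⟩ := exists_block_bound (s := 1) le_rfl hk
        (h := fun j (y : Fin m → E × ℝ) => ∑ i, (y i).2 * M i j)
        (T := 4 * Real.exp 3 * (4 : ℝ) ^ (1 / 2 : ℝ) * maxEntry M ^ 2 * k * m)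
        (by
          have : (1 : ℝ) ≤ k := by exact_mod_cast hk
          positivity)
        (fun j => (hmom j).1) (fun j => (hmom j).2)
        (by
          have h1 : (n : ℝ) ≤ Real.exp 1 * n := le_mul_of_one_le_left (by linarith)
            (Real.one_le_exp (by norm_num))
          have h2 := Real.exp_le_exp.2 hk4
          rw [Real.exp_log (by positivity)] at h2
          push_cast; linarith)
      refine ⟨fun y => √s * b y, hbi.const_mul _, fun y => mul_nonneg (Real.sqrt_nonneg _) (hb0 y),
        .of_forall fun y S hS => ?_, ?_⟩
      · rw [mul_pow, Real.sq_sqrt hs0.le]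
        calc _ ≤ ∑ j ∈ S, b y ^ 2 := Finset.sum_le_sum fun j _ => by
              simpa using hb y {j} (by simp)
          _ = S.card * b y ^ 2 := by simp
          _ ≤ s * b y ^ 2 := by
              have : (S.card : ℝ) ≤ s := by exact_mod_cast hS
              gcongr
      · rw [integral_const_mul]
        have hln0 : 0 ≤ Real.log n := by linarith
        have h4 : (4 : ℝ) ^ (1 / 2 : ℝ) = 2 := by
          rw [← Real.sqrt_eq_rpow, show (4 : ℝ) = 2 ^ 2 by norm_num, Real.sqrt_sq (by norm_num)]
        have hroot : √((1 : ℕ) * Real.exp 4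
              * (4 * Real.exp 3 * (4 : ℝ) ^ (1 / 2 : ℝ) * maxEntry M ^ 2 * k * m))
            ≤ 4 * Real.exp 4 * (√m * √(Real.log n) * maxEntry M) := by
          rw [Real.sqrt_le_left (by positivity)]
          rw [h4, mul_pow, mul_pow, mul_pow, mul_pow, Real.sq_sqrt hm0.le, Real.sq_sqrt hln0]
          have e3 : Real.exp 3 ≤ Real.exp 4 := Real.exp_le_exp.2 (by norm_num)
          calc _ = 8 * (Real.exp 4 * Real.exp 3) * (maxEntry M ^ 2 * m) * k := by push_cast; ring
            _ ≤ 8 * (Real.exp 4 * Real.exp 4) * (maxEntry M ^ 2 * m) * (2 * Real.log n) := by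
                gcongr
            _ = _ := by ring
        calc √s * ∫ y, b y ∂_ ≤ √s * (2 * (4 * Real.exp 4 * (√m * √(Real.log n) * maxEntry M))) := by
              gcongr
              exact hbint.trans (by gcongr)
          _ = _ := by rw [Real.sqrt_mul hs0.le]; ring

/-- The expected supremum of the symmetrized process over the unit cone. -/
theorem integral_iSup_rademacher_le {m : ℕ} (μ : Fin m → Measure (Fin n → ℝ))
    [∀ i, IsProbabilityMeasure (μ i)] (M : Matrix (Fin m) (Fin n) ℝ) {s : ℕ} (hs : 1 ≤ s)
    (hsn : s ≤ n) (hn : 2 ≤ n) (hm2 : 2 ≤ m)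
    (hm : Real.log (Real.exp 1 * n) ≤ m) {k : ℕ} (hk : 1 ≤ k)
    (hL : ∀ i j, MemLp (fun x : Fin n → ℝ => x j - M i j) (2 * k : ℕ) (μ i))
    {κ α : ℝ} (hκ : 0 < κ) (hα : 1 / 2 ≤ α)
    (heven : ∀ i j q, 1 ≤ q → q ≤ k →
      ∫ x, (x j - M i j) ^ (2 * q) ∂μ i ≤ (κ * (2 * q : ℝ) ^ α) ^ (2 * q))
    (hmk : (2 * k : ℝ) ^ max (2 * α - 1) 1 ≤ m) (hnk : (n : ℝ) ≤ s * Real.exp (4 * k))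
    {ρ : ℝ} (hρ : 0 < ρ) (hρ1 : ρ ≤ 1) {V : Type*} [Finite V] [Nonempty V] {v : V → Fin n → ℝ}
    (hv : ∀ w, v w ∈ unitCone n s ρ) {c : ℝ} (hc : 0 ≤ c) :
    ∫ y, ⨆ w, ∑ i, c * ((y i).2 * ∑ j, (y i).1 j * v w j)
        ∂Measure.pi (fun i => (μ i).prod rademacher)
      ≤ c * (3 / ρ) * (4 * Real.exp 4 * √m * ((2 : ℝ) ^ α * κ * √(s * k))
        + 8 * Real.exp 4 * √m
          * min (localFrobenius M s) (√((s : ℝ) * Real.log n) * maxEntry M)) := by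
  have hm0 : (0 : ℝ) < m := by
    have : (2 : ℝ) ≤ m := by exact_mod_cast hm2
    linarith
  have hs0 : (0 : ℝ) < s := by exact_mod_cast hs
  have hk0 : (1 : ℝ) ≤ k := by exact_mod_cast hk
  obtain ⟨b₁, hb₁i, hb₁0, hb₁, hb₁int⟩ := exists_block_bound_mean μ M hs hsn hn hm2 hm
  have hmom := fun j => integral_rademacher_sum_pow_le μ (g := fun i x => x j - M i j)
    (fun i => by fun_prop) hk (fun i => hL i j) hκ hα (fun i q hq hqk => heven i j q hq hqk) hmk
  obtain ⟨b₀, hb₀i, hb₀0, hb₀, hb₀int⟩ := exists_block_bound hs hk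
    (h := fun j (y : Fin m → (Fin n → ℝ) × ℝ) => ∑ i, (y i).2 * ((y i).1 j - M i j))
    (T := 4 * Real.exp 3 * (4 : ℝ) ^ α * κ ^ 2 * k * m) (by positivity)
    (fun j => (hmom j).1) (fun j => (hmom j).2) hnk
  have hroot : √(s * Real.exp 4 * (4 * Real.exp 3 * (4 : ℝ) ^ α * κ ^ 2 * k * m))
      ≤ 2 * Real.exp 4 * √m * ((2 : ℝ) ^ α * κ * √(s * k)) := by
    rw [Real.sqrt_le_left (by positivity)]
    have e3 : Real.exp 3 ≤ Real.exp 4 := Real.exp_le_exp.2 (by norm_num)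
    have e4 : (4 : ℝ) ^ α = ((2 : ℝ) ^ α) ^ 2 := by
      rw [← Real.rpow_natCast, ← Real.rpow_mul (by norm_num), mul_comm, Real.rpow_mul (by norm_num)]
      norm_num
    simp only [mul_pow]
    rw [Real.sq_sqrt hm0.le, Real.sq_sqrt (by positivity), ← e4]
    calc _ = 4 * (Real.exp 4 * Real.exp 3) * ((4 : ℝ) ^ α * κ ^ 2 * k * m * s) := by ring
      _ ≤ 4 * (Real.exp 4 * Real.exp 4) * ((4 : ℝ) ^ α * κ ^ 2 * k * m * s) := by gcongr
      _ = _ := by ring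
  have hle : ∀ᵐ y ∂Measure.pi fun i => (μ i).prod rademacher,
      (⨆ w, ∑ i, c * ((y i).2 * ∑ j, (y i).1 j * v w j)) ≤ c * (3 / ρ) * (b₀ y + b₁ y) := by
    filter_upwards [hb₁] with y hy
    refine ciSup_le fun w => ?_
    have h0 := dotProduct_le_of_mem_unitCone hs hρ hρ1 (hv w) (hb₀0 y) (hb₀ y)
    have h1 := dotProduct_le_of_mem_unitCone hs hρ hρ1 (hv w) (hb₁0 y) hy
    -- The Rademacher sum of the rows splits into a centred part, controlled by moments, and the
    -- signed mean; the cone inequality is applied to each.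
    have e : ∑ i, c * ((y i).2 * ∑ j, (y i).1 j * v w j)
        = c * (∑ j, (∑ i, (y i).2 * ((y i).1 j - M i j)) * v w j
          + ∑ j, (∑ i, (y i).2 * M i j) * v w j) := by
      rw [← Finset.mul_sum, ← Finset.sum_add_distrib]
      congr 1
      simp only [Finset.mul_sum]
      rw [Finset.sum_comm]
      refine Finset.sum_congr rfl fun j _ => ?_
      rw [← add_mul, ← Finset.sum_add_distrib, Finset.sum_mul]
      exact Finset.sum_congr rfl fun i _ => by ring
    rw [e, mul_assoc]
    exact mul_le_mul_of_nonneg_left (by linarith) hc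
  have hI : Integrable (fun y : Fin m → (Fin n → ℝ) × ℝ =>
      ⨆ w, ∑ i, c * ((y i).2 * ∑ j, (y i).1 j * v w j))
      (Measure.pi fun i => (μ i).prod rademacher) := by
    refine integrable_iSup (fun w => by fun_prop) fun w => ?_
    refine integrable_sum_pi (μ := fun i => (μ i).prod rademacher)
      (g := fun i z => c * (z.2 * ∑ j, z.1 j * v w j)) fun i => ?_
    refine integrable_snd_mul_fst (f := fun x : Fin n → ℝ => ∑ j, x j * v w j) ?_ c
    refine integrable_finsetSum _ fun j _ => Integrable.mul_const ?_ _
    have : Integrable (fun x : Fin n → ℝ => x j - M i j + M i j) (μ i) :=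
      ((hL i j).integrable (by exact_mod_cast (by omega : 1 ≤ 2 * k))).add (integrable_const _)
    simpa using this
  refine (integral_mono_ae hI ((hb₀i.add hb₁i).const_mul _) hle).trans ?_
  simp only [Pi.add_apply]
  rw [integral_const_mul, integral_add hb₀i hb₁i]
  refine mul_le_mul_of_nonneg_left (add_le_add ?_ hb₁int) (by positivity)
  refine hb₀int.trans ?_
  linarith

end Width

/-! ### Reduction to finitely many unit vectors. -/

section Reduction

variable {m n : ℕ}

/-- If the `ℓ₁` term does not already suffice, the normalized vector lies in the cone; scaling back
gives `‖v‖₂ ≤ τ ‖M v‖₂`, which dominates the norm on `S`. -/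
theorem l2RNSP_of_unitCone {M : Matrix (Fin m) (Fin n) ℝ} {s : ℕ} {ρ τ : ℝ} (hρ : 0 ≤ ρ)
    (hτ : 0 < τ) (H : ∀ v ∈ unitCone n s ρ, 1 ≤ τ * √(∑ i, (M.mulVec v) i ^ 2)) : L2RNSP M s ρ τ := by
  intro S hS v
  have hτn : 0 ≤ τ * √(∑ i, (M.mulVec v) i ^ 2) := by positivity
  rcases le_total (√(∑ j ∈ S, v j ^ 2)) (ρ / √(s : ℝ) * ∑ j ∈ Sᶜ, |v j|) with h | h
  · linarith
  · have hSle : √(∑ j ∈ S, v j ^ 2) ≤ √(∑ j, v j ^ 2) :=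
      Real.sqrt_le_sqrt (Finset.sum_le_sum_of_subset_of_nonneg (Finset.subset_univ S)
        fun j _ _ => sq_nonneg _)
    rcases (Real.sqrt_nonneg (∑ j, v j ^ 2)).eq_or_lt with h0 | hN
    · have h1 : √(∑ j ∈ S, v j ^ 2) = 0 := le_antisymm (h0 ▸ hSle) (Real.sqrt_nonneg _)
      have hv : ∀ j, v j = 0 := fun j => by
        have h2 : ∑ j, v j ^ 2 = 0 := by
          rwa [eq_comm, Real.sqrt_eq_zero (Finset.sum_nonneg fun j _ => sq_nonneg _)] at h0
        have := (Finset.sum_eq_zero_iff_of_nonneg fun j _ => sq_nonneg (v j)).1 h2 j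
          (Finset.mem_univ j)
        simpa using this
      rw [h1]
      simp only [hv, abs_zero, Finset.sum_const_zero, mul_zero, zero_add]
      exact hτn
    · set N := √(∑ j, v j ^ 2) with hNdef
      have hN2 : N ^ 2 = ∑ j, v j ^ 2 := Real.sq_sqrt (Finset.sum_nonneg fun j _ => sq_nonneg _)
      have hsq : ∀ T : Finset (Fin n), ∑ j ∈ T, (N⁻¹ * v j) ^ 2 = N⁻¹ ^ 2 * ∑ j ∈ T, v j ^ 2 :=
        fun T => by rw [Finset.mul_sum]; exact Finset.sum_congr rfl fun j _ => by ring
      have hu : (N⁻¹ • v) ∈ unitCone n s ρ := by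
        refine ⟨?_, S, hS, ?_⟩
        · simp only [Pi.smul_apply, smul_eq_mul]
          rw [hsq, ← hN2]; field_simp
        · simp only [Pi.smul_apply, smul_eq_mul]
          rw [hsq, Real.sqrt_mul (by positivity), Real.sqrt_sq (by positivity)]
          simp only [abs_mul, abs_of_pos (inv_pos.2 hN)]
          rw [← Finset.mul_sum]
          calc _ = N⁻¹ * (ρ / √(s : ℝ) * ∑ j ∈ Sᶜ, |v j|) := by ring
            _ ≤ _ := mul_le_mul_of_nonneg_left h (by positivity)
      have h1 := H _ hu
      rw [Matrix.mulVec_smul] at h1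
      simp only [Pi.smul_apply, smul_eq_mul, mul_pow] at h1
      rw [← Finset.mul_sum, Real.sqrt_mul (by positivity), Real.sqrt_sq (by positivity)] at h1
      have h2 : N ≤ τ * √(∑ i, (M.mulVec v) i ^ 2) := by
        have h3 := mul_le_mul_of_nonneg_left h1 hN.le
        calc N = N * 1 := (mul_one _).symm
          _ ≤ _ := h3
          _ = _ := by field_simp
      have hp : 0 ≤ ρ / √(s : ℝ) * ∑ j ∈ Sᶜ, |v j| :=
        mul_nonneg (by positivity) (Finset.sum_nonneg fun j _ => abs_nonneg _)
      linarith

/-- A uniform lower bound over finite subfamilies of the cone extends to the whole cone. -/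
theorem le_measureReal_l2RNSP {Ω : Type*} [MeasurableSpace Ω] {P : Measure Ω}
    [IsProbabilityMeasure P] {A : Ω → Matrix (Fin m) (Fin n) ℝ}
    (hA : ∀ i j, Measurable fun ω => A ω i j) {s : ℕ} {ρ τ δ : ℝ} (hρ : 0 ≤ ρ) (hτ : 0 < τ)
    (hδ : δ ≤ 1)
    (H : ∀ (N : ℕ) (v : Fin (N + 1) → Fin n → ℝ), (∀ w, v w ∈ unitCone n s ρ) →
      δ ≤ P.real {ω | ∀ w, 1 ≤ τ * √(∑ i, ((A ω).mulVec (v w)) i ^ 2)}) :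
    δ ≤ P.real {ω | L2RNSP (A ω) s ρ τ} := by
  rcases (unitCone n s ρ).eq_empty_or_nonempty with h | h
  · have : {ω | L2RNSP (A ω) s ρ τ} = Set.univ := by
      refine Set.eq_univ_of_forall fun ω => l2RNSP_of_unitCone hρ hτ fun v hv => ?_
      rw [h] at hv; exact absurd hv (Set.notMem_empty v)
    rw [this]; simpa using hδ
  · have : Nonempty (unitCone n s ρ) := h.to_subtype
    -- The events for initial segments of a dense sequence decrease, so a bound valid for each of
    -- them passes to their intersection; continuity of `v ↦ ‖A v‖₂` then covers the whole cone.
    set u := TopologicalSpace.denseSeq (unitCone n s ρ)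
    set G : ℕ → Set Ω := fun N =>
      {ω | ∀ w : Fin (N + 1), 1 ≤ τ * √(∑ i, ((A ω).mulVec (u w)) i ^ 2)} with hG
    have hmeas : ∀ N, MeasurableSet (G N) := fun N => by
      simp only [hG, Set.ofPred_forall]
      refine MeasurableSet.iInter fun w => measurableSet_le measurable_const ?_
      simp only [Matrix.mulVec, dotProduct]
      fun_prop
    have hanti : Antitone G := fun N N' hN ω hω w => hω ⟨w, by omega⟩
    have hlim := tendsto_measure_iInter_atTop (μ := P)
      (fun N => (hmeas N).nullMeasurableSet) hanti ⟨0, measure_ne_top _ _⟩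
    have hlim' := (ENNReal.tendsto_toReal (measure_ne_top P _)).comp hlim
    refine (ge_of_tendsto' hlim' fun N => H N (fun w => u w) fun w => (u w).2).trans ?_
    refine measureReal_mono fun ω hω => l2RNSP_of_unitCone hρ hτ fun v hv => ?_
    have hcl : IsClosed {x : unitCone n s ρ | 1 ≤ τ * √(∑ i, ((A ω).mulVec x.1) i ^ 2)} := by
      have hc : Continuous fun x : Fin n → ℝ => τ * √(∑ i, ((A ω).mulVec x) i ^ 2) := by
        simp only [Matrix.mulVec, dotProduct]
        fun_prop
      exact (isClosed_le continuous_const hc).preimage continuous_subtype_val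
    refine (TopologicalSpace.denseRange_denseSeq (unitCone n s ρ)).induction_on
      (p := fun x => 1 ≤ τ * √(∑ i, ((A ω).mulVec x.1) i ^ 2)) ⟨v, hv⟩ hcl fun N => ?_
    exact Set.mem_iInter.1 hω N (Fin.last N)

end Reduction

/-! ### The small-ball method for the random matrix. -/

section Model

variable {Ω : Type*} [MeasurableSpace Ω] {P : Measure Ω} {m n : ℕ}

/-- Independent entries with finite fourth moments and a common positive variance. -/
structure IsModel (P : Measure Ω) (A : Ω → Matrix (Fin m) (Fin n) ℝ) : Prop where
  meas : ∀ i j, Measurable fun ω => A ω i j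
  memLp : ∀ i j, MemLp (fun ω => A ω i j) 4 P
  indep : iIndepFun (fun (q : Fin m × Fin n) (ω : Ω) => A ω q.1 q.2) P
  central : IsCentral P A 2
  pos : 0 < maxCentralMoment P A 2

variable {A : Ω → Matrix (Fin m) (Fin n) ℝ}

theorem maxCentralMoment_nonneg (k : ℕ) : 0 ≤ maxCentralMoment P A k :=
  Real.iSup_nonneg fun _ => abs_nonneg _

theorem centralMoment_entry (i : Fin m) (j : Fin n) (k : ℕ) :
    centralMoment (fun ω => A ω i j) k P = ∫ ω, (A ω i j - meanMatrix P A i j) ^ k ∂P := rfl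

theorem abs_integral_le_maxCentralMoment (i : Fin m) (j : Fin n) (k : ℕ) :
    |∫ ω, (A ω i j - meanMatrix P A i j) ^ k ∂P| ≤ maxCentralMoment P A k :=
  le_iSup_finite (fun q : Fin m × Fin n => |centralMoment (fun ω => A ω q.1 q.2) k P|) (i, j)

theorem sq_le_momentK : maxCentralMoment P A 2 ^ 2 ≤ momentK P A := by
  have h2 := maxCentralMoment_nonneg (P := P) (A := A) 2
  have h3 := maxCentralMoment_nonneg (P := P) (A := A) 3
  have h4 := maxCentralMoment_nonneg (P := P) (A := A) 4
  have := mul_nonneg h2 h3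
  unfold momentK; linarith

theorem integral_pow_four_le_momentK (i : Fin m) (j : Fin n) :
    ∫ ω, (A ω i j - meanMatrix P A i j) ^ 4 ∂P ≤ momentK P A := by
  have h2 := maxCentralMoment_nonneg (P := P) (A := A) 2
  have h3 := maxCentralMoment_nonneg (P := P) (A := A) 3
  have h4 := (le_abs_self _).trans (abs_integral_le_maxCentralMoment (P := P) (A := A) i j 4)
  have := mul_nonneg h2 h3
  have := sq_nonneg (maxCentralMoment P A 2)
  unfold momentK; linarith

theorem IsModel.integral_sq (h : IsModel P A) (i : Fin m) (j : Fin n) :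
    ∫ ω, (A ω i j - meanMatrix P A i j) ^ 2 ∂P = maxCentralMoment P A 2 := by
  have : Nonempty (Fin m × Fin n) := ⟨(i, j)⟩
  have h1 : ∀ q : Fin m × Fin n, |centralMoment (fun ω => A ω q.1 q.2) 2 P|
      = ∫ ω, (A ω i j - meanMatrix P A i j) ^ 2 ∂P := fun q => by
    rw [h.central 2 (by norm_num) le_rfl q.1 i q.2 j, centralMoment_entry,
      abs_of_nonneg (integral_nonneg fun ω => sq_nonneg _)]
  unfold maxCentralMoment
  simp only [h1, ciSup_const]

theorem IsModel.momentK_pos (h : IsModel P A) : 0 < momentK P A :=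
  lt_of_lt_of_le (pow_pos h.pos 2) sq_le_momentK

/-- The law of the `i`-th row of `A`. -/
def rowLaw (P : Measure Ω) (A : Ω → Matrix (Fin m) (Fin n) ℝ) (i : Fin m) :
    Measure (Fin n → ℝ) := P.map fun ω => A ω i

/-- Lower bound on the small-ball probability of the rows of `A`. -/
def smallBall (P : Measure Ω) (A : Ω → Matrix (Fin m) (Fin n) ℝ) : ℝ :=
  maxCentralMoment P A 2 ^ 2 / (100 * momentK P A)

/-- The small-ball scale of the rows of `A`. -/
def scale (P : Measure Ω) (A : Ω → Matrix (Fin m) (Fin n) ℝ) : ℝ :=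
  √(maxCentralMoment P A 2 / 8)

theorem IsModel.scale_pos (h : IsModel P A) : 0 < scale P A :=
  Real.sqrt_pos.2 (by have := h.pos; positivity)

theorem IsModel.scale_sq (h : IsModel P A) : 8 * scale P A ^ 2 = maxCentralMoment P A 2 := by
  rw [scale, Real.sq_sqrt (by have := h.pos; positivity)]; ring

theorem IsModel.smallBall_pos (h : IsModel P A) : 0 < smallBall P A := by
  have := h.pos; have := h.momentK_pos
  unfold smallBall; positivity

theorem IsModel.measurable_row (h : IsModel P A) (i : Fin m) :
    Measurable fun ω => A ω i := measurable_pi_iff.2 fun j => h.meas i j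

theorem IsModel.integral_rowLaw (h : IsModel P A) (i : Fin m) {f : (Fin n → ℝ) → ℝ}
    (hf : Measurable f) : ∫ x, f x ∂rowLaw P A i = ∫ ω, f (A ω i) ∂P :=
  integral_map (h.measurable_row i).aemeasurable hf.aestronglyMeasurable

theorem IsModel.memLp_rowLaw (h : IsModel P A) (i : Fin m) (j : Fin n) {c : ℝ} {p : ENNReal}
    (hp : MemLp (fun ω => A ω i j - c) p P) :
    MemLp (fun x : Fin n → ℝ => x j - c) p (rowLaw P A i) :=
  (memLp_map_measure_iff (Measurable.aestronglyMeasurable (by fun_prop))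
    (h.measurable_row i).aemeasurable).2 hp

variable [IsProbabilityMeasure P]

theorem IsModel.isProbabilityMeasure_rowLaw (h : IsModel P A) (i : Fin m) :
    IsProbabilityMeasure (rowLaw P A i) :=
  Measure.isProbabilityMeasure_map (h.measurable_row i).aemeasurable

theorem IsModel.map_eq_pi (h : IsModel P A) :
    P.map (fun ω i => A ω i) = Measure.pi (rowLaw P A) := by
  have h1 : iIndepFun (fun (i : Fin m) (ω : Ω) (j : Fin n) => A ω i j) P :=
    iIndepFun_curry (X := fun (q : Fin m × Fin n) ω => A ω q.1 q.2) (fun q => h.meas q.1 q.2)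
      h.indep
  exact (iIndepFun_iff_map_fun_eq_pi_map fun i => (h.measurable_row i).aemeasurable).1 h1

theorem IsModel.memLp_centered (h : IsModel P A) (i : Fin m) (j : Fin n) :
    MemLp (fun ω => A ω i j - meanMatrix P A i j) 4 P :=
  (h.memLp i j).sub (memLp_const _)

/-- The centred form `∑ v j X j` has variance `μ₂` and fourth moment at most `3K`. The mean of the
row only shifts it by a constant, which the small-ball estimate tolerates. -/
theorem IsModel.smallBall_le (h : IsModel P A) (i : Fin m) {v : Fin n → ℝ}
    (hv : ∑ j, v j ^ 2 = 1) :
    smallBall P A ≤ ∫ x, ramp (scale P A) (∑ j, x j * v j) ∂rowLaw P A i := by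
  have hm : Measurable fun x : Fin n → ℝ => ramp (scale P A) (∑ j, x j * v j) :=
    (measurable_ramp _).comp (by fun_prop)
  rw [h.integral_rowLaw i hm]
  set X : Fin n → Ω → ℝ := fun j ω => A ω i j - meanMatrix P A i j with hX
  have hXm : ∀ j, Measurable (X j) := fun j => (h.meas i j).sub_const _
  have hind : iIndepFun X P :=
    (h.indep.precomp (g := fun j : Fin n => (i, j)) fun j j' hj => by simpa using hj).comp
      (fun j x => x - meanMatrix P A i j) fun j => by fun_prop
  have h1 : ∀ j, ∫ ω, X j ω ∂P = 0 := fun j => by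
    simp only [hX]
    rw [integral_sub ((h.memLp i j).integrable (by norm_num)) (integrable_const _)]
    simp [meanMatrix]
  obtain ⟨m1, m2, m4⟩ := moments_sum_of_centered hind hXm (fun j => h.memLp_centered i j) h1
    (fun j => h.integral_sq i j) (fun j => integral_pow_four_le_momentK i j) sq_le_momentK v
    Finset.univ
  rw [hv, mul_one] at m2
  rw [hv, one_pow, mul_one] at m4
  have hLp : MemLp (fun ω => ∑ j, v j * X j ω) (4 : ℕ) P :=
    memLp_finsetSum _ fun j _ => (h.memLp_centered i j).const_mul (v j)
  have key := le_integral_ramp_add_const hLp m1 h.pos m2 m4 sq_le_momentK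
    (∑ j, v j * meanMatrix P A i j) h.scale_pos h.scale_sq
  refine key.trans (le_of_eq ?_)
  congr 1
  ext ω
  congr 1
  rw [← Finset.sum_add_distrib]
  exact Finset.sum_congr rfl fun j _ => by simp only [hX]; ring

theorem mul_sum_ramp_le_sqrt {ξ : ℝ} (hξ : 0 < ξ) (hm : 0 < m) (M : Matrix (Fin m) (Fin n) ℝ)
    (v : Fin n → ℝ) :
    ξ * ∑ i, ramp ξ (∑ j, M i j * v j) ≤ √m * √(∑ i, (M.mulVec v) i ^ 2) := by
  calc ξ * ∑ i, ramp ξ (∑ j, M i j * v j) ≤ ∑ i, |(M.mulVec v) i| := by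
        rw [Finset.mul_sum]
        exact Finset.sum_le_sum fun i _ => mul_ramp_le_abs hξ _
    _ ≤ _ := by
        rw [← Real.sqrt_mul (by positivity)]
        refine Real.le_sqrt_of_sq_le ?_
        have := sq_sum_le_card_mul_sum_sq (s := (Finset.univ : Finset (Fin m)))
          (f := fun i => |(M.mulVec v) i|)
        simpa using this

/-- The small-ball method for a finite family of unit vectors. -/
theorem IsModel.le_measureReal_finite (h : IsModel P A) (hm : 0 < m) {V : Type*} [Finite V]
    [Nonempty V] {v : V → Fin n → ℝ} (hv : ∀ w, ∑ j, v w j ^ 2 = 1) {τ : ℝ} (hτ : 0 < τ)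
    (hτm : 1 ≤ τ * (scale P A * √m * smallBall P A / 2))
    (hE : ∫ x, rampDeviation (rowLaw P A) (fun w x => ∑ j, x j * v w j) (scale P A) x
      ∂Measure.pi (rowLaw P A) ≤ m * smallBall P A / 4) :
    1 - Real.exp (-(smallBall P A ^ 2 * m / 32))
      ≤ P.real {ω | ∀ w, 1 ≤ τ * √(∑ i, ((A ω).mulVec (v w)) i ^ 2)} := by
  have := h.isProbabilityMeasure_rowLaw
  have hξ := h.scale_pos
  have hp := h.smallBall_pos
  have hm0 : (0 : ℝ) < m := by exact_mod_cast hm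
  have hbad := measure_ramp_sum_le (rowLaw P A) (f := fun w (x : Fin n → ℝ) => ∑ j, x j * v w j)
    (fun w => by fun_prop) hp.le (fun i w => h.smallBall_le i (hv w)) hE
  have hRm : Measurable fun ω i => A ω i := measurable_pi_iff.2 h.measurable_row
  have hBm : MeasurableSet {x : Fin m → Fin n → ℝ |
      ∃ w, ∑ i, ramp (scale P A) (∑ j, x i j * v w j) ≤ m * smallBall P A / 2} := by
    simp only [Set.ofPred_exists]
    refine MeasurableSet.iUnion fun w => measurableSet_le ?_ measurable_const
    exact Finset.measurable_sum _ fun i _ => (measurable_ramp _).comp (by fun_prop)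
  rw [← h.map_eq_pi, map_measureReal_apply hRm hBm] at hbad
  set B := (fun ω i => A ω i) ⁻¹' {x : Fin m → Fin n → ℝ |
      ∃ w, ∑ i, ramp (scale P A) (∑ j, x i j * v w j) ≤ m * smallBall P A / 2} with hB
  have hcompl : P.real Bᶜ = 1 - P.real B := probReal_compl_eq_one_sub (hRm hBm)
  have hsub : P.real Bᶜ ≤ P.real {ω | ∀ w, 1 ≤ τ * √(∑ i, ((A ω).mulVec (v w)) i ^ 2)} := by
    refine measureReal_mono fun ω hω w => ?_
    have h1 : m * smallBall P A / 2 ≤ ∑ i, ramp (scale P A) (∑ j, A ω i j * v w j) := by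
      by_contra hlt
      exact hω ⟨w, (not_le.1 hlt).le⟩
    have h2 := (mul_le_mul_of_nonneg_left h1 hξ.le).trans (mul_sum_ramp_le_sqrt hξ hm (A ω) (v w))
    have hrm : 0 < √(m : ℝ) := Real.sqrt_pos.2 hm0
    have h3 : scale P A * √m * smallBall P A / 2 ≤ √(∑ i, ((A ω).mulVec (v w)) i ^ 2) := by
      rw [← mul_le_mul_iff_right₀ hrm]
      refine le_trans (le_of_eq ?_) h2
      nth_rewrite 3 [← Real.mul_self_sqrt hm0.le]
      ring
    exact hτm.trans (mul_le_mul_of_nonneg_left h3 hτ.le)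
  linarith

/-- The small-ball method for the unit cone, with the width bounded through moments. -/
theorem IsModel.le_measureReal_of_width (h : IsModel P A) {s : ℕ} (hs : 1 ≤ s)
    (hsn : s ≤ n) (hn : 2 ≤ n) (hm2 : 2 ≤ m) (hm : Real.log (Real.exp 1 * n) ≤ m) {k : ℕ}
    (hk : 1 ≤ k) {κ α : ℝ} (hκ : 0 < κ) (hα : 1 / 2 ≤ α)
    (hL : ∀ i j, MemLp (fun ω => A ω i j - meanMatrix P A i j) (2 * k : ℕ) P)
    (heven : ∀ i j q, 1 ≤ q → q ≤ k →
      ∫ ω, (A ω i j - meanMatrix P A i j) ^ (2 * q) ∂P ≤ (κ * (2 * q : ℝ) ^ α) ^ (2 * q))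
    (hmk : (2 * k : ℝ) ^ max (2 * α - 1) 1 ≤ m) (hnk : (n : ℝ) ≤ s * Real.exp (4 * k))
    {ρ : ℝ} (hρ : 0 < ρ) (hρ1 : ρ ≤ 1) {τ : ℝ} (hτ : 0 < τ)
    (hτm : 1 ≤ τ * (scale P A * √m * smallBall P A / 2))
    (hW : 192 * Real.exp 4 * ((2 : ℝ) ^ α * κ * √(s * k) + meanTerm P A s)
      ≤ ρ * (scale P A * √m * smallBall P A))
    {V : Type*} [Finite V] [Nonempty V] {v : V → Fin n → ℝ} (hv : ∀ w, v w ∈ unitCone n s ρ) :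
    1 - Real.exp (-(smallBall P A ^ 2 * m / 32))
      ≤ P.real {ω | ∀ w, 1 ≤ τ * √(∑ i, ((A ω).mulVec (v w)) i ^ 2)} := by
  have := h.isProbabilityMeasure_rowLaw
  have hξ := h.scale_pos
  have hp := h.smallBall_pos
  have hm0 : (0 : ℝ) < m := by
    have : (2 : ℝ) ≤ m := by exact_mod_cast hm2
    linarith
  refine h.le_measureReal_finite (by omega) (fun w => (hv w).1) hτ hτm ?_
  have hint : ∀ (i : Fin m) (w : V),
      Integrable (fun x : Fin n → ℝ => ∑ j, x j * v w j) (rowLaw P A i) := fun i w => by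
    refine integrable_finsetSum _ fun j _ => Integrable.mul_const ?_ _
    have h1 : MemLp (fun x : Fin n → ℝ => x j - 0) 4 (rowLaw P A i) :=
      h.memLp_rowLaw i j (by simpa using h.memLp i j)
    simpa using h1.integrable (by norm_num)
  refine (integral_rampDeviation_le (rowLaw P A)
    (f := fun w (x : Fin n → ℝ) => ∑ j, x j * v w j) (fun w => by fun_prop) hint hξ).trans ?_
  refine (integral_iSup_rademacher_le (rowLaw P A) (meanMatrix P A) hs hsn hn hm2 hm hk
    (fun i j => h.memLp_rowLaw i j (hL i j)) hκ hα
    (fun i j q hq hqk => by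
      rw [h.integral_rowLaw i (f := fun x => (x j - meanMatrix P A i j) ^ (2 * q)) (by fun_prop)]
      exact heven i j q hq hqk) hmk hnk hρ hρ1 hv (c := 2 * (scale P A)⁻¹) (by positivity)).trans ?_
  change 2 * (scale P A)⁻¹ * (3 / ρ) * (_ + 8 * Real.exp 4 * √m * meanTerm P A s) ≤ _
  have hx : 0 ≤ (2 : ℝ) ^ α * κ * √(s * k) := by positivity
  set a := (2 : ℝ) ^ α * κ * √(s * k)
  set F := meanTerm P A s
  have he := Real.exp_pos 4
  have hrm : 0 < √(m : ℝ) := Real.sqrt_pos.2 hm0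
  calc _ ≤ 2 * (scale P A)⁻¹ * (3 / ρ) * (8 * Real.exp 4 * √m * (a + F)) := by
        refine mul_le_mul_of_nonneg_left ?_ (by positivity)
        have : 0 ≤ Real.exp 4 * √m * a := by positivity
        linarith
    -- The constant is `192 = 2 · 3 · 8 · 4`: contraction, the cone inequality, the width bound, and
    -- the quarter of `m p` allowed for the expectation.
    _ = (192 * Real.exp 4 * (a + F)) * ((scale P A)⁻¹ * √m / (4 * ρ)) := by
        field_simp; ring
    _ ≤ (ρ * (scale P A * √m * smallBall P A)) * ((scale P A)⁻¹ * √m / (4 * ρ)) :=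
        mul_le_mul_of_nonneg_right hW (by positivity)
    _ = (√m * √m) * smallBall P A / 4 := by field_simp
    _ = _ := by rw [Real.mul_self_sqrt hm0.le]

end Model

/-! ### From the sample-size condition to the width condition; the cases `n ≥ 3` and `n = 1`. -/

section Assembly

variable {Ω : Type*} [MeasurableSpace Ω] {P : Measure Ω} {m n : ℕ}
  {A : Ω → Matrix (Fin m) (Fin n) ℝ}

theorem IsReasonable.integral_pow_le {Y : Ω → ℝ} (hY : Measurable Y) {κ α r : ℝ} (hκ : 0 < κ)
    (h : IsReasonable P Y κ α r) {q : ℕ} (hq : 1 ≤ q) (hqr : (2 * q : ℝ) ≤ r) :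
    MemLp Y (2 * q : ℕ) P ∧ ∫ ω, Y ω ^ (2 * q) ∂P ≤ (κ * (2 * q : ℝ) ^ α) ^ (2 * q) := by
  have hq1 : (1 : ℝ) ≤ q := by exact_mod_cast hq
  have h1 := h (2 * q) (by linarith) hqr
  have e : ENNReal.ofReal (2 * q : ℝ) = ((2 * q : ℕ) : ENNReal) := by
    rw [← ENNReal.ofReal_natCast]; push_cast; rfl
  rw [e] at h1
  have hL : MemLp Y (2 * q : ℕ) P :=
    ⟨hY.aestronglyMeasurable, h1.trans_lt ENNReal.ofReal_lt_top⟩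
  refine ⟨hL, ?_⟩
  have hne : ((2 * q : ℕ) : ENNReal) ≠ 0 := by
    exact_mod_cast (by omega : 2 * q ≠ 0)
  rw [hL.eLpNorm_eq_integral_rpow_norm hne (ENNReal.natCast_ne_top _),
    ENNReal.ofReal_le_ofReal_iff (by positivity), ENNReal.toReal_natCast] at h1
  have e2 : ∫ ω, ‖Y ω‖ ^ ((2 * q : ℕ) : ℝ) ∂P = ∫ ω, Y ω ^ (2 * q) ∂P := by
    congr 1; ext ω
    rw [Real.rpow_natCast, Real.norm_eq_abs, (even_two_mul q).pow_abs]
  rw [e2] at h1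
  have hI : 0 ≤ ∫ ω, Y ω ^ (2 * q) ∂P := integral_nonneg fun ω => (even_two_mul q).pow_nonneg _
  calc ∫ ω, Y ω ^ (2 * q) ∂P = ((∫ ω, Y ω ^ (2 * q) ∂P) ^ (((2 * q : ℕ) : ℝ)⁻¹)) ^ (2 * q) :=
        (Real.rpow_inv_natCast_pow hI (by omega)).symm
    _ ≤ _ := pow_le_pow_left₀ (by positivity) h1 _

theorem meanTerm_nonneg (s : ℕ) : 0 ≤ meanTerm P A s :=
  le_min (localFrobenius_nonneg _ _) (mul_nonneg (Real.sqrt_nonneg _) (maxEntry_nonneg _))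

/-- Taking square roots makes the condition on `m` linear. Of the factor `300`, `100` comes from the
small-ball bound and `3` from `√8 ≤ 3` in the scale. -/
theorem IsModel.le_scale_mul (h : IsModel P A) {τ ρ W D : ℝ} (hτ : 0 < τ) (hρ : 0 < ρ)
    (hW : 0 ≤ W) (hD : 0 ≤ D)
    (hm : (300 * D) ^ 2 * (momentK P A / (maxCentralMoment P A 2 ^ (5 / 2 : ℝ) * τ)
      * (1 + τ * ρ⁻¹ * W)) ^ 2 ≤ m) :
    D * (1 / τ + W / ρ) ≤ scale P A * √m * smallBall P A := by
  have hσ := h.pos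
  have hK := h.momentK_pos
  rw [← mul_pow] at hm
  have h1 := Real.le_sqrt_of_sq_le hm
  have hσ5 : maxCentralMoment P A 2 ^ (5 / 2 : ℝ)
      = maxCentralMoment P A 2 ^ 2 * √(maxCentralMoment P A 2) := by
    rw [Real.sqrt_eq_rpow, ← Real.rpow_natCast, ← Real.rpow_add hσ]; norm_num
  have hsc : √(maxCentralMoment P A 2) ≤ 3 * scale P A := by
    rw [Real.sqrt_le_left (mul_nonneg (by norm_num) h.scale_pos.le), mul_pow]
    have := h.scale_sq
    nlinarith [sq_nonneg (scale P A)]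
  rw [hσ5] at h1
  set σ := maxCentralMoment P A 2
  set K := momentK P A
  have hrσ : 0 < √σ := Real.sqrt_pos.2 hσ
  have hX : 0 ≤ D * (1 / τ + W / ρ) := by positivity
  have h2 : 300 * (D * (1 / τ + W / ρ)) * K ≤ √m * (σ ^ 2 * √σ) := by
    have e : 300 * D * (K / (σ ^ 2 * √σ * τ) * (1 + τ * ρ⁻¹ * W))
        = 300 * (D * (1 / τ + W / ρ)) * K / (σ ^ 2 * √σ) := by field_simp
    rw [e, div_le_iff₀ (by positivity)] at h1
    exact h1
  have h3 : √m * (σ ^ 2 * √σ) ≤ √m * (σ ^ 2 * (3 * scale P A)) := by gcongr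
  rw [smallBall]
  change _ ≤ scale P A * √m * (σ ^ 2 / (100 * K))
  rw [← mul_div_assoc, le_div_iff₀ (by positivity)]
  linarith

theorem exp_four_le : Real.exp 4 ≤ 55 := by
  have h := Real.exp_one_lt_d9
  have e : Real.exp 4 = (Real.exp 1 ^ 2) ^ 2 := by
    rw [← pow_mul, ← Real.exp_nat_mul]; norm_num
  rw [e]
  have h0 := Real.exp_pos 1
  have h2 : Real.exp 1 ^ 2 ≤ 7.3891 := by nlinarith
  nlinarith [sq_nonneg (Real.exp 1)]

theorem one_le_log_div {s : ℕ} (hs : 1 ≤ s) (hsn : s ≤ n) :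
    1 ≤ Real.log (Real.exp 1 * n / s) := by
  have hs0 : (0 : ℝ) < s := by exact_mod_cast hs
  have hsn' : (s : ℝ) ≤ n := by exact_mod_cast hsn
  have hn0 : (0 : ℝ) < n := hs0.trans_le hsn'
  rw [Real.le_log_iff_exp_le (by positivity), mul_div_assoc]
  exact le_mul_of_one_le_right (Real.exp_pos 1).le ((one_le_div hs0).2 hsn')

variable [IsProbabilityMeasure P]

/-- `n ≥ 3` gives `log(en) ≥ 2`, so second moments are covered by the moment hypothesis. An order `k
≤ log(en/s)` with `4k ≥ log(en/s)` can then be used in the width bound. -/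
theorem IsModel.le_measureReal_of_three_le (h : IsModel P A) {s : ℕ} {κ α ρ τ : ℝ}
    (hκ : 0 < κ) (hα : 1 / 2 ≤ α)
    (hr : ∀ i j, IsReasonable P (fun ω => A ω i j - meanMatrix P A i j) κ α
      (Real.log (Real.exp 1 * n)))
    (hρ : 0 < ρ) (hρ1 : ρ < 1) (hτ : 0 < τ) (hs : 1 ≤ s) (hsn : s ≤ n) (hn : 3 ≤ n)
    (hm : Real.log (Real.exp 1 * n) ^ max (2 * α - 1) 1 ≤ m)
    (hR : 10 ^ 6 * (1 / τ + (Real.exp (2 * α) * κ * √((s : ℝ) * Real.log (Real.exp 1 * n / s))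
      + meanTerm P A s) / ρ) ≤ scale P A * √m * smallBall P A) :
    1 - Real.exp (-(smallBall P A ^ 2 * m / 32)) ≤ P.real {ω | L2RNSP (A ω) s ρ τ} := by
  have hs0 : (1 : ℝ) ≤ s := by exact_mod_cast hs
  have hsn' : (s : ℝ) ≤ n := by exact_mod_cast hsn
  have hn3 : (3 : ℝ) ≤ n := by exact_mod_cast hn
  have hx1 := one_le_log_div hs hsn
  set x := Real.log (Real.exp 1 * n / s) with hx
  set L := Real.log (Real.exp 1 * n) with hLdef
  have he1 := Real.exp_one_lt_d9
  have hep := Real.exp_pos 1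
  have hL2 : 2 ≤ L := by
    rw [hLdef, Real.log_mul hep.ne' (by linarith), Real.log_exp]
    have : 1 ≤ Real.log n := by
      rw [Real.le_log_iff_exp_le (by linarith)]; linarith
    linarith
  have hxL : x ≤ L := Real.log_le_log (by positivity) (div_le_self (by positivity) hs0)
  obtain ⟨k, hk, hk2, hk4⟩ := exists_moment_order x
  have hk0 : (1 : ℝ) ≤ k := by exact_mod_cast hk
  have hkL : (2 * k : ℝ) ≤ L := hk2.trans (max_le hL2 hxL)
  have hkx : (k : ℝ) ≤ x := by
    rcases le_max_iff.1 hk2 with h | h <;> linarith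
  have hmax : (0 : ℝ) ≤ max (2 * α - 1) 1 := zero_le_one.trans (le_max_right _ _)
  have hLm : L ≤ m := by
    refine le_trans ?_ hm
    calc L = L ^ (1 : ℝ) := (Real.rpow_one _).symm
      _ ≤ _ := Real.rpow_le_rpow_of_exponent_le (by linarith) (le_max_right _ _)
  have hm2 : 2 ≤ m := by
    have : (2 : ℝ) ≤ m := hL2.trans hLm
    exact_mod_cast this
  have hF := meanTerm_nonneg (P := P) (A := A) s
  set R := scale P A * √m * smallBall P A with hRdef
  set W := Real.exp (2 * α) * κ * √((s : ℝ) * x) + meanTerm P A s with hW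
  have hW0 : 0 ≤ W := by positivity
  have hmeas : ∀ i j, Measurable fun ω => A ω i j - meanMatrix P A i j :=
    fun i j => (h.meas i j).sub_const _
  have h1τ : 0 < 1 / τ := by positivity
  have hWρ : 0 ≤ W / ρ := by positivity
  refine le_measureReal_l2RNSP h.meas hρ.le hτ
    (sub_le_self _ (Real.exp_pos _).le) fun N v hv => ?_
  refine h.le_measureReal_of_width hs hsn (by omega) hm2 hLm hk hκ hα
    (fun i j => ((hr i j).integral_pow_le (hmeas i j) hκ hk hkL).1)
    (fun i j q hq hqk => ((hr i j).integral_pow_le (hmeas i j) hκ hq (by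
      have : (q : ℝ) ≤ k := by exact_mod_cast hqk
      linarith)).2)
    ((Real.rpow_le_rpow (by positivity) hkL hmax).trans hm) ?_ hρ hρ1.le hτ ?_ ?_ hv
  · have h2 := Real.exp_le_exp.2 hk4
    rw [hx, Real.exp_log (by positivity), div_le_iff₀ (by linarith)] at h2
    have : (n : ℝ) ≤ Real.exp 1 * n :=
      le_mul_of_one_le_left (by linarith) (Real.one_le_exp (by norm_num))
    linarith
  · rw [← hRdef]
    have h2 : 2 * (1 / τ) ≤ R := by linarith
    have h3 := mul_le_mul_of_nonneg_left h2 hτ.le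
    have e : τ * (2 * (1 / τ)) = 2 := by field_simp
    linarith
  · have h2 : (2 : ℝ) ^ α ≤ Real.exp (2 * α) := by
      rw [Real.exp_mul]
      refine Real.rpow_le_rpow (by norm_num) ?_ (by linarith)
      linarith [Real.add_one_le_exp (2 : ℝ)]
    have h3 : (2 : ℝ) ^ α * κ * √(s * k) + meanTerm P A s ≤ W := by
      rw [hW]; gcongr
    have h4 : 192 * Real.exp 4 ≤ 10 ^ 6 := by linarith [exp_four_le]
    have h5 : 10 ^ 6 * (W / ρ) ≤ R := by linarith
    calc _ ≤ 10 ^ 6 * W := mul_le_mul h4 h3 (by positivity) (by norm_num)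
      _ = ρ * (10 ^ 6 * (W / ρ)) := by field_simp
      _ ≤ ρ * R := mul_le_mul_of_nonneg_left h5 hρ.le

theorem integral_rampDeviation_unit {E : Type*} [MeasurableSpace E] (μ : Fin m → Measure E)
    [∀ i, IsProbabilityMeasure (μ i)] {f : E → ℝ} (hf : Measurable f) (ξ : ℝ) :
    ∫ x, rampDeviation μ (fun _ : Unit => f) ξ x ∂Measure.pi μ = 0 := by
  have hi : ∀ i, Integrable (fun y => ramp ξ (f y)) (μ i) := fun i =>
    Integrable.of_bound ((measurable_ramp ξ).comp hf).aestronglyMeasurable 1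
      (.of_forall fun y => abs_ramp_le_one ξ _)
  have hev : ∀ i, Integrable (fun x : Fin m → E => ramp ξ (f (x i))) (Measure.pi μ) := fun i =>
    ((measurePreserving_eval μ i).integrable_comp (hi i).aestronglyMeasurable).2 (hi i)
  simp only [rampDeviation, ciSup_const]
  have hsub : ∀ i, Integrable (fun x : Fin m → E =>
      (∫ y, ramp ξ (f y) ∂μ i) - ramp ξ (f (x i))) (Measure.pi μ) := fun i =>
    (integrable_const _).sub (hev i)
  rw [integral_finsetSum _ fun i _ => hsub i]
  refine Finset.sum_eq_zero fun i _ => ?_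
  rw [integral_sub (integrable_const _) (hev i)]
  have h := measurePreserving_eval μ i
  have e : ∫ x, ramp ξ (f (x i)) ∂Measure.pi μ = ∫ y, ramp ξ (f y) ∂μ i := by
    rw [← h.map_eq]
    exact (integral_map (f := fun y => ramp ξ (f y)) h.measurable.aemeasurable
      ((measurable_ramp ξ).comp hf).aestronglyMeasurable).symm
  rw [e]; simp

/-- In dimension one the unit vectors are `±1`, which give the same value of `‖A v‖₂`. The supremum
is over a single point, so the expected deviation is zero and no width bound is needed. -/
theorem IsModel.le_measureReal_of_one {A : Ω → Matrix (Fin m) (Fin 1) ℝ} (h : IsModel P A)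
    (hm : 0 < m) {s : ℕ} {ρ τ : ℝ} (hρ : 0 < ρ) (hτ : 0 < τ)
    (hR : 10 ^ 6 * (1 / τ) ≤ scale P A * √m * smallBall P A) :
    1 - Real.exp (-(smallBall P A ^ 2 * m / 32)) ≤ P.real {ω | L2RNSP (A ω) s ρ τ} := by
  have := h.isProbabilityMeasure_rowLaw
  have h1τ : 0 < 1 / τ := by positivity
  have hfin := h.le_measureReal_finite hm (V := Unit) (v := fun _ _ => 1) (by simp) hτ
    (by
      have h2 : 2 * (1 / τ) ≤ scale P A * √m * smallBall P A := by linarith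
      have h3 := mul_le_mul_of_nonneg_left h2 hτ.le
      have e : τ * (2 * (1 / τ)) = 2 := by field_simp
      linarith)
    (by
      rw [integral_rampDeviation_unit (rowLaw P A)
        (f := fun x : Fin 1 → ℝ => ∑ j, x j * 1) (by fun_prop)]
      have := h.smallBall_pos
      positivity)
  refine hfin.trans (measureReal_mono fun ω hω => l2RNSP_of_unitCone hρ.le hτ fun v hv => ?_)
  have h1 := hω ()
  have hv0 : v 0 ^ 2 = 1 := by simpa using hv.1
  simpa [Matrix.mulVec, dotProduct, mul_pow, hv0] using h1

end Assembly

/-! ### Two columns, where the moment hypothesis stops short of order two. -/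

section TwoColumns

variable {Ω : Type*} [MeasurableSpace Ω] {P : Measure Ω} {m : ℕ}
  {A : Ω → Matrix (Fin m) (Fin 2) ℝ}

theorem maxEntry_le_two_mul_meanTerm {s : ℕ} (hs : 1 ≤ s) (hs2 : s ≤ 2) :
    maxEntry (meanMatrix P A) ≤ 2 * meanTerm P A s := by
  set M := meanMatrix P A
  have h0 := maxEntry_nonneg M
  have hs1 : (1 : ℝ) ≤ s := by exact_mod_cast hs
  have hl2 := Real.log_two_gt_d9
  have h1 : maxEntry M ≤ localFrobenius M s := by
    refine Real.iSup_le (fun q => ?_) (localFrobenius_nonneg _ _)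
    have h1 := sum_le_localFrobenius M hs2 (S := {q.2}) (by simpa using hs)
    rw [Finset.sum_singleton] at h1
    have h2 : M q.1 q.2 ^ 2 ≤ ∑ i, M i q.2 ^ 2 :=
      Finset.single_le_sum (f := fun i => M i q.2 ^ 2) (fun i _ => sq_nonneg _)
        (Finset.mem_univ q.1)
    exact abs_le_of_sq_le_sq (h2.trans h1) (localFrobenius_nonneg _ _)
  have h2 : 1 / 2 ≤ √((s : ℝ) * Real.log (2 : ℕ)) := by
    refine Real.le_sqrt_of_sq_le ?_
    push_cast
    nlinarith
  have h3 : 1 / 2 * maxEntry M ≤ meanTerm P A s :=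
    le_min (by linarith) (mul_le_mul_of_nonneg_right h2 h0)
  linarith

theorem meanTerm_two_le : meanTerm P A 2 ≤ 2 * maxEntry (meanMatrix P A) := by
  refine (min_le_right _ _).trans ?_
  refine mul_le_mul_of_nonneg_right ?_ (maxEntry_nonneg _)
  rw [Real.sqrt_le_left (by norm_num)]
  have := Real.log_two_lt_d9
  push_cast; linarith

/-- With `s = 2` the cone is the whole circle, so `ρ` can be replaced by `1` in the width bound. -/
theorem mem_unitCone_two {v : Fin 2 → ℝ} (hv : ∑ j, v j ^ 2 = 1) : v ∈ unitCone 2 2 1 := by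
  refine ⟨hv, Finset.univ, by simp, ?_⟩
  simp

/-- Two complementary nearly diagonal rows bound a two-column matrix from below. -/
theorem one_le_of_good_rows {M : Matrix (Fin m) (Fin 2) ℝ} {ξ τ : ℝ} (hξ : 0 < ξ) (hτ : 0 < τ)
    (hτξ : 4 ≤ τ * ξ) {i i' : Fin m} (h00 : ξ ≤ |M i 0|) (h01 : |M i 1| ≤ ξ / 2)
    (h10 : |M i' 0| ≤ ξ / 2) (h11 : ξ ≤ |M i' 1|) {v : Fin 2 → ℝ} (hv : ∑ j, v j ^ 2 = 1) :
    1 ≤ τ * √(∑ i, (M.mulVec v) i ^ 2) := by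
  rw [Fin.sum_univ_two] at hv
  have key : ∀ (l : Fin m) (x y a b : ℝ), M.mulVec v l = x * a + y * b → ξ ≤ |x| →
      |y| ≤ ξ / 2 → |b| ≤ |a| → a ^ 2 + b ^ 2 = 1 → 1 ≤ τ * √(∑ i, (M.mulVec v) i ^ 2) := by
    intro l x y a b he hx hy hab h1
    have ha : 1 / 2 ≤ |a| := by
      have := sq_abs a; have := sq_abs b
      nlinarith [abs_nonneg a, abs_nonneg b]
    have h2 : ξ / 4 ≤ |M.mulVec v l| := by
      have h3 : |x * a| - |y * b| ≤ |x * a + y * b| := by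
        have := abs_sub_abs_le_abs_sub (x * a) (-(y * b))
        rwa [abs_neg, sub_neg_eq_add] at this
      rw [he]
      refine le_trans ?_ h3
      rw [abs_mul, abs_mul]
      have h4 : |y| * |b| ≤ ξ / 2 * |a| := mul_le_mul hy hab (abs_nonneg _) (by positivity)
      have h5 : ξ * |a| ≤ |x| * |a| := mul_le_mul_of_nonneg_right hx (abs_nonneg _)
      nlinarith
    have h6 : |M.mulVec v l| ≤ √(∑ i, (M.mulVec v) i ^ 2) :=
      Real.abs_le_sqrt (Finset.single_le_sum (f := fun i => (M.mulVec v) i ^ 2)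
        (fun i _ => sq_nonneg _) (Finset.mem_univ l))
    have h7 := mul_le_mul_of_nonneg_left (h2.trans h6) hτ.le
    linarith
  have hmul : ∀ l, M.mulVec v l = M l 0 * v 0 + M l 1 * v 1 := fun l => by
    simp [Matrix.mulVec, dotProduct, Fin.sum_univ_two]
  rcases le_total |v 1| |v 0| with h | h
  · exact key i _ _ _ _ (hmul i) h00 h01 h hv
  · exact key i' _ _ _ _ ((hmul i').trans (add_comm _ _)) h11 h10 h (by linarith)

variable [IsProbabilityMeasure P]

/-- The small-ball estimate at a coordinate vector, since the ramp is dominated by the indicator of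
`|t| ≥ ξ`. -/
theorem IsModel.smallBall_le_measureReal (h : IsModel P A) (i : Fin m) (j : Fin 2) :
    smallBall P A ≤ P.real {ω | scale P A ≤ |A ω i j|} := by
  classical
  have hmeas : MeasurableSet {ω | scale P A ≤ |A ω i j|} :=
    measurableSet_le measurable_const (h.meas i j).abs
  have h1 := h.smallBall_le i (v := Pi.single j 1) (by
    rw [Finset.sum_eq_single j] <;> simp +contextual)
  simp only [Pi.single_apply, mul_ite, mul_one, mul_zero, Finset.sum_ite_eq', Finset.mem_univ,
    if_true] at h1
  rw [h.integral_rowLaw i (f := fun x => ramp (scale P A) (x j))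
    ((measurable_ramp _).comp (measurable_pi_apply j))] at h1
  refine h1.trans ?_
  rw [← integral_indicator_one hmeas]
  refine integral_mono (Integrable.of_bound
    ((measurable_ramp _).comp (h.meas i j)).aestronglyMeasurable 1
    (.of_forall fun ω => abs_ramp_le_one _ _))
    ((integrable_const (1 : ℝ)).indicator hmeas) fun ω => ?_
  by_cases hω : scale P A ≤ |A ω i j|
  · rw [Set.indicator_of_mem (by exact hω)]
    exact ramp_le_one _ _
  · rw [Set.indicator_of_notMem (by exact hω)]
    have : |A ω i j| / scale P A - 1 ≤ 0 := by
      rw [sub_nonpos, div_le_one h.scale_pos]; exact (not_le.1 hω).le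
    simp only [ramp, max_eq_left this]
    norm_num

/-- Markov's inequality with the first absolute moment, the order `p = 1` being always available. -/
theorem IsModel.half_le_measureReal (h : IsModel P A) {κ α r : ℝ} (hκ : 0 < κ) (hr : 1 ≤ r)
    {i : Fin m} {j : Fin 2}
    (hre : IsReasonable P (fun ω => A ω i j - meanMatrix P A i j) κ α r)
    (hsmall : 4 * (κ + maxEntry (meanMatrix P A)) ≤ scale P A) :
    1 / 2 ≤ P.real {ω | |A ω i j| ≤ scale P A / 2} := by
  have hξ := h.scale_pos
  have h1 := hre 1 le_rfl hr
  rw [ENNReal.ofReal_one, Real.one_rpow, mul_one] at h1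
  have hint : Integrable (fun ω => A ω i j) P := (h.memLp i j).integrable (by norm_num)
  have hcint : Integrable (fun ω => A ω i j - meanMatrix P A i j) P :=
    hint.sub (integrable_const _)
  rw [eLpNorm_one_eq_lintegral_enorm, ← ofReal_integral_norm_eq_lintegral_enorm hcint,
    ENNReal.ofReal_le_ofReal_iff hκ.le] at h1
  have h2 : ∫ ω, |A ω i j| ∂P ≤ κ + maxEntry (meanMatrix P A) := by
    calc ∫ ω, |A ω i j| ∂P
        ≤ ∫ ω, (‖A ω i j - meanMatrix P A i j‖ + |meanMatrix P A i j|) ∂P := by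
          refine integral_mono hint.abs (hcint.norm.add (integrable_const _)) fun ω => ?_
          have := abs_add_le (A ω i j - meanMatrix P A i j) (meanMatrix P A i j)
          rw [sub_add_cancel] at this
          exact this
      _ = ∫ ω, ‖A ω i j - meanMatrix P A i j‖ ∂P + |meanMatrix P A i j| := by
          rw [integral_add hcint.norm (integrable_const _)]; simp
      _ ≤ _ := add_le_add h1 (abs_le_maxEntry _ _ _)
  have hmk := mul_meas_ge_le_integral_of_nonneg (μ := P) (f := fun ω => |A ω i j|)
    (.of_forall fun ω => abs_nonneg _) hint.abs (scale P A / 2)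
  have hmeas : MeasurableSet {ω | scale P A / 2 ≤ |A ω i j|} :=
    measurableSet_le measurable_const (h.meas i j).abs
  have h3 : P.real {ω | scale P A / 2 ≤ |A ω i j|} ≤ 1 / 2 := by
    have h4 : scale P A / 2 * P.real {ω | scale P A / 2 ≤ |A ω i j|} ≤ scale P A / 2 * (1 / 2) := by
      refine hmk.trans (h2.trans ?_); linarith
    exact le_of_mul_le_mul_left h4 (by positivity)
  have h5 : P.real {ω | scale P A / 2 ≤ |A ω i j|}ᶜ ≤ P.real {ω | |A ω i j| ≤ scale P A / 2} :=
    measureReal_mono fun ω hω =>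
      (not_le.1 (show ¬ scale P A / 2 ≤ |A ω i j| from hω)).le
  rw [probReal_compl_eq_one_sub hmeas] at h5
  linarith

/-- The row `2l + b` of an `m`-row matrix. -/
def pairRow (m : ℕ) (l : Fin (m / 2)) (b : Fin 2) : Fin m :=
  ⟨2 * l + b, by have := l.2; have := b.2; omega⟩

/-- Group the rows into `m/2` independent pairs. A pair is good if its `2 × 2` block has diagonal
entries at least `ξ` and off-diagonal entries at most `ξ/2` in modulus, which has probability at
least `(p/2)²`. One good pair suffices, so failure has probability at most `(1 - p²/4)^(m/2)`. -/
theorem IsModel.le_measureReal_of_pairs (h : IsModel P A) {κ α r : ℝ} (hκ : 0 < κ) (hr : 1 ≤ r)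
    (hre : ∀ i j, IsReasonable P (fun ω => A ω i j - meanMatrix P A i j) κ α r)
    (hsmall : 4 * (κ + maxEntry (meanMatrix P A)) ≤ scale P A) (hm2 : 2 ≤ m) {s : ℕ} {ρ τ : ℝ}
    (hρ : 0 < ρ) (hτ : 0 < τ) (hτξ : 4 ≤ τ * scale P A) :
    1 - Real.exp (-(smallBall P A ^ 2 * m / 32)) ≤ P.real {ω | L2RNSP (A ω) s ρ τ} := by
  have hξ := h.scale_pos
  have hp := h.smallBall_pos
  set ξ := scale P A with hξdef
  set p := smallBall P A with hpdef
  set X : Fin (m / 2) × (Fin 2 × Fin 2) → Ω → ℝ :=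
    fun q ω => A ω (pairRow m q.1 q.2.1) q.2.2 with hX
  have hXm : ∀ q, Measurable (X q) := fun q => h.meas _ _
  have hXi : iIndepFun X P := by
    refine h.indep.precomp (g := fun q : Fin (m / 2) × (Fin 2 × Fin 2) =>
      (pairRow m q.1 q.2.1, q.2.2)) ?_
    rintro ⟨l, b, j⟩ ⟨l', b', j'⟩ hq
    simp only [pairRow, Prod.mk.injEq, Fin.mk.injEq] at hq ⊢
    have := b.2; have := b'.2
    refine ⟨Fin.ext (by omega), Fin.ext (by omega), hq.2⟩
  have hblock : iIndepFun (fun (l : Fin (m / 2)) (ω : Ω) (q : Fin 2 × Fin 2) => X (l, q) ω) P :=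
    iIndepFun_curry hXm hXi
  set T : Fin 2 × Fin 2 → Set ℝ := fun q =>
    if q.1 = q.2 then {t | ξ ≤ |t|} else {t | |t| ≤ ξ / 2} with hT
  have hTm : ∀ q, MeasurableSet (T q) := fun q => by
    simp only [hT]; split_ifs
    · exact measurableSet_le measurable_const measurable_id.abs
    · exact measurableSet_le measurable_id.abs measurable_const
  set G : Set (Fin 2 × Fin 2 → ℝ) := {x | ∀ q, x q ∈ T q} with hG
  have hGm : MeasurableSet G := by
    have : G = Set.univ.pi T := by ext x; simp [hG]
    rw [this]; exact MeasurableSet.univ_pi hTm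
  have hgood : ∀ l : Fin (m / 2),
      p ^ 2 / 4 ≤ P.real ((fun ω q => X (l, q) ω) ⁻¹' G) := fun l => by
    have hl : iIndepFun (fun q : Fin 2 × Fin 2 => X (l, q)) P :=
      hXi.precomp (g := fun q => (l, q)) fun q q' hq => by simpa using hq
    have e : (fun ω q => X (l, q) ω) ⁻¹' G
        = ⋂ q ∈ (Finset.univ : Finset (Fin 2 × Fin 2)), X (l, q) ⁻¹' T q := by
      ext ω; simp [hG]
    have hprod := hl.measure_inter_preimage_eq_mul Finset.univ (sets := T) fun q _ => hTm q
    have hd : ∀ b : Fin 2, p ≤ P.real (X (l, b, b) ⁻¹' T (b, b)) := fun b => by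
      simpa [hT, hX] using! h.smallBall_le_measureReal (pairRow m l b) b
    have ho : ∀ b j : Fin 2, b ≠ j → 1 / 2 ≤ P.real (X (l, b, j) ⁻¹' T (b, j)) :=
      fun b j hbj => by
        have := h.half_le_measureReal hκ hr (hre (pairRow m l b) j) hsmall
        simpa [hT, hX, hbj] using! this
    rw [measureReal_def, e, hprod, ENNReal.toReal_prod, Fintype.prod_prod_type]
    simp only [Fin.prod_univ_two]
    change _ ≤ (P.real (X (l, 0, 0) ⁻¹' T (0, 0)) * P.real (X (l, 0, 1) ⁻¹' T (0, 1)))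
      * (P.real (X (l, 1, 0) ⁻¹' T (1, 0)) * P.real (X (l, 1, 1) ⁻¹' T (1, 1)))
    calc p ^ 2 / 4 = (p * (1 / 2)) * ((1 / 2) * p) := by ring
      _ ≤ _ := by
        gcongr
        · exact hd 0
        · exact ho 0 1 (by norm_num)
        · exact ho 1 0 (by norm_num)
        · exact hd 1
  have hWm : ∀ l : Fin (m / 2), Measurable fun ω q => X (l, q) ω := fun l =>
    measurable_pi_iff.2 fun q => hXm _
  set B : Set Ω := ⋂ l ∈ (Finset.univ : Finset (Fin (m / 2))),
    (fun ω q => X (l, q) ω) ⁻¹' Gᶜ with hB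
  have hBm : MeasurableSet B :=
    Finset.measurableSet_biInter _ fun l _ => hWm l hGm.compl
  have hPB : P.real B ≤ (1 - p ^ 2 / 4) ^ (m / 2) := by
    rw [measureReal_def, hB, hblock.measure_inter_preimage_eq_mul Finset.univ
      (sets := fun _ => Gᶜ) fun l _ => hGm.compl, ENNReal.toReal_prod]
    calc _ ≤ ∏ l : Fin (m / 2), (1 - p ^ 2 / 4) := by
          refine Finset.prod_le_prod (fun l _ => ENNReal.toReal_nonneg) fun l _ => ?_
          change P.real ((fun ω q => X (l, q) ω) ⁻¹' G)ᶜ ≤ _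
          rw [probReal_compl_eq_one_sub (hWm l hGm)]
          linarith [hgood l]
      _ = _ := by simp
  have hexp : (1 - p ^ 2 / 4) ^ (m / 2) ≤ Real.exp (-(p ^ 2 * m / 32)) := by
    have hbase : 0 ≤ 1 - p ^ 2 / 4 := by
      have hl : 0 < m / 2 := by omega
      have h1 := hgood ⟨0, hl⟩
      have h2 : P.real ((fun ω q => X (⟨0, hl⟩, q) ω) ⁻¹' G) ≤ 1 := measureReal_le_one
      linarith
    calc (1 - p ^ 2 / 4) ^ (m / 2) ≤ Real.exp (-(p ^ 2 / 4)) ^ (m / 2) :=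
          pow_le_pow_left₀ hbase (by linarith [Real.add_one_le_exp (-(p ^ 2 / 4))]) _
      _ = Real.exp (-(((m / 2 : ℕ) : ℝ) * (p ^ 2 / 4))) := by
          rw [← Real.exp_nat_mul]; congr 1; ring
      _ ≤ _ := by
          rw [Real.exp_le_exp, neg_le_neg_iff]
          -- `m / 2` is rounded down, so only `m ≤ 3 (m / 2)` is available, valid for `m ≥ 2`; the
          -- exponent has room for this loss.
          have h1 : (m : ℝ) ≤ 3 * ((m / 2 : ℕ) : ℝ) := by
            exact_mod_cast (by omega : m ≤ 3 * (m / 2))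
          nlinarith [sq_nonneg p]
  have hcompl : P.real Bᶜ = 1 - P.real B := probReal_compl_eq_one_sub hBm
  have hsub : P.real Bᶜ ≤ P.real {ω | L2RNSP (A ω) s ρ τ} := by
    refine measureReal_mono fun ω hω => l2RNSP_of_unitCone hρ.le hτ fun v hv => ?_
    have : ∃ l : Fin (m / 2), (fun q => X (l, q) ω) ∈ G := by
      by_contra hno
      push Not at hno
      exact hω (by simpa [hB] using! hno)
    obtain ⟨l, hl⟩ := this
    refine one_le_of_good_rows hξ hτ hτξ (i := pairRow m l 0) (i' := pairRow m l 1)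
      ?_ ?_ ?_ ?_ hv.1
    · simpa [hT, hX] using! hl (0, 0)
    · simpa [hT, hX] using! hl (0, 1)
    · simpa [hT, hX] using! hl (1, 0)
    · simpa [hT, hX] using! hl (1, 1)
  linarith

theorem IsModel.le_measureReal_of_two (h : IsModel P A) {s : ℕ} {κ α ρ τ : ℝ}
    (hκ : 0 < κ) (hα : 1 / 2 ≤ α)
    (hr : ∀ i j, IsReasonable P (fun ω => A ω i j - meanMatrix P A i j) κ α
      (Real.log (Real.exp 1 * (2 : ℕ))))
    (hρ : 0 < ρ) (hρ1 : ρ < 1) (hτ : 0 < τ) (hs : 1 ≤ s) (hs2 : s ≤ 2)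
    (hm : Real.log (Real.exp 1 * (2 : ℕ)) ^ max (2 * α - 1) 1 ≤ m)
    (hR : 10 ^ 6 * (1 / τ + (Real.exp (2 * α) * κ
      * √((s : ℝ) * Real.log (Real.exp 1 * (2 : ℕ) / s)) + meanTerm P A s) / ρ)
        ≤ scale P A * √m * smallBall P A) :
    1 - Real.exp (-(smallBall P A ^ 2 * m / 32)) ≤ P.real {ω | L2RNSP (A ω) s ρ τ} := by
  have hξ := h.scale_pos
  have hp := h.smallBall_pos
  have hL : Real.log (Real.exp 1 * (2 : ℕ)) = 1 + Real.log 2 := by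
    rw [Real.log_mul (Real.exp_pos 1).ne' (by norm_num), Real.log_exp]; norm_num
  have hl2 := Real.log_two_gt_d9
  have hl2' := Real.log_two_lt_d9
  have hLm : Real.log (Real.exp 1 * (2 : ℕ)) ≤ m := by
    refine le_trans ?_ hm
    calc _ = Real.log (Real.exp 1 * (2 : ℕ)) ^ (1 : ℝ) := (Real.rpow_one _).symm
      _ ≤ _ := Real.rpow_le_rpow_of_exponent_le (by rw [hL]; linarith) (le_max_right _ _)
  have hm2 : 2 ≤ m := by
    have : (1 : ℝ) < m := by rw [hL] at hLm; linarith
    exact_mod_cast this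
  have hmR : (2 : ℝ) ≤ m := by exact_mod_cast hm2
  have hrm : 0 < √(m : ℝ) := Real.sqrt_pos.2 (by linarith)
  have hF := meanTerm_nonneg (P := P) (A := A) s
  have hME := maxEntry_le_two_mul_meanTerm (P := P) (A := A) hs hs2
  have hME0 := maxEntry_nonneg (meanMatrix P A)
  have h1τ : 0 < 1 / τ := by positivity
  have hκW : κ ≤ Real.exp (2 * α) * κ * √((s : ℝ) * Real.log (Real.exp 1 * (2 : ℕ) / s)) := by
    have h1 : 1 ≤ Real.exp (2 * α) := Real.one_le_exp (by linarith)
    have h2 : 1 ≤ √((s : ℝ) * Real.log (Real.exp 1 * (2 : ℕ) / s)) := by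
      refine Real.one_le_sqrt.2 (one_le_mul_of_one_le_of_one_le (by exact_mod_cast hs)
        (one_le_log_div hs hs2))
    calc κ = 1 * κ * 1 := by ring
      _ ≤ _ := by gcongr
  set W := Real.exp (2 * α) * κ * √((s : ℝ) * Real.log (Real.exp 1 * (2 : ℕ) / s))
    + meanTerm P A s with hW
  have hW0 : 0 ≤ W := by linarith
  have hWρ : W ≤ W / ρ := le_div_self hW0 hρ hρ1.le
  set R := scale P A * √m * smallBall P A with hRdef
  -- If `√m p` is large, the width bound with `κ = √μ₂`, `α = 1/2` and `k = 1` is of order `ξ +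
  -- F(A)`, both small compared with `R`. Otherwise `R < 120000 ξ`, and the condition on `m` forces
  -- `1/τ`, `κ` and the mean to be small compared with `ξ`, as the pairs argument requires.
  rcases le_or_gt (120000 : ℝ) (√m * smallBall P A) with hbig | hbig
  · refine le_measureReal_l2RNSP h.meas hρ.le hτ (sub_le_self _ (Real.exp_pos _).le)
      fun N v hv => ?_
    have hσ := h.pos
    refine h.le_measureReal_of_width (s := 2) (by norm_num) le_rfl le_rfl hm2 hLm (k := 1) le_rfl
      (κ := √(maxCentralMoment P A 2)) (α := 1 / 2) (Real.sqrt_pos.2 hσ) le_rfl ?_ ?_ ?_ ?_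
      one_pos le_rfl hτ ?_ ?_ fun w => mem_unitCone_two (hv w).1
    · exact fun i j => (h.memLp_centered i j).mono_exponent (by norm_num)
    · intro i j q hq hq1
      obtain rfl : q = 1 := le_antisymm hq1 hq
      rw [mul_one, h.integral_sq i j, mul_pow, Real.sq_sqrt hσ.le, Nat.cast_one, mul_one,
        ← Real.sqrt_eq_rpow, Real.sq_sqrt (by norm_num)]
      linarith
    · have : max (2 * (1 / 2 : ℝ) - 1) 1 = 1 := by norm_num
      rw [this, Real.rpow_one]; push_cast; linarith
    · have := Real.one_le_exp (show (0 : ℝ) ≤ 4 * (1 : ℕ) by norm_num)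
      push_cast at *; linarith
    · rw [← hRdef]
      have h2 : 2 * (1 / τ) ≤ R := by linarith
      have h3 := mul_le_mul_of_nonneg_left h2 hτ.le
      have e : τ * (2 * (1 / τ)) = 2 := by field_simp
      linarith
    · rw [← hRdef, one_mul]
      have hsc : √(maxCentralMoment P A 2) ≤ 2.8285 * scale P A := by
        rw [Real.sqrt_le_left (by positivity), mul_pow]
        have := h.scale_sq
        nlinarith [sq_nonneg (scale P A)]
      have h2 : (2 : ℝ) ^ (1 / 2 : ℝ) * √(maxCentralMoment P A 2) * √((2 : ℕ) * (1 : ℕ))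
          = 2 * √(maxCentralMoment P A 2) := by
        rw [← Real.sqrt_eq_rpow]
        push_cast
        rw [mul_one, mul_right_comm, Real.mul_self_sqrt (by norm_num)]
      rw [h2]
      have h3 : scale P A * 120000 ≤ R := by
        rw [hRdef, mul_assoc]; exact mul_le_mul_of_nonneg_left hbig hξ.le
      have h4 := meanTerm_two_le (P := P) (A := A)
      have h5 : 2 * √(maxCentralMoment P A 2) + meanTerm P A 2
          ≤ 5.657 * scale P A + 4 * meanTerm P A s := by linarith
      have h6 : 10 ^ 6 * meanTerm P A s ≤ R := by linarith
      have h7 : 192 * Real.exp 4 ≤ 10560 := by linarith [exp_four_le]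
      calc _ ≤ 10560 * (5.657 * scale P A + 4 * meanTerm P A s) := by
            refine mul_le_mul h7 h5 (add_nonneg (by positivity) (meanTerm_nonneg _)) (by norm_num)
        _ ≤ R := by linarith
  · have hRlt : R < 120000 * scale P A := by
      rw [hRdef, mul_assoc, mul_comm]; exact mul_lt_mul_of_pos_right hbig hξ
    refine h.le_measureReal_of_pairs hκ (by rw [hL]; linarith) hr (by linarith) hm2 hρ hτ ?_
    have h2 : 4 * (1 / τ) ≤ scale P A := by linarith
    have h3 := mul_le_mul_of_nonneg_left h2 hτ.le
    have e : τ * (4 * (1 / τ)) = 4 := by field_simp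
    linarith

end TwoColumns

end RobustNSP

end

/-! ### The main theorem. -/

theorem mainTheorem1 :
    ∃ C c : ℝ, 0 < C ∧ 0 < c ∧
      ∀ {Ω : Type*} [MeasurableSpace Ω] (P : Measure Ω) [IsProbabilityMeasure P]
        (m n s : ℕ) (A : Ω → Matrix (Fin m) (Fin n) ℝ) (κ α ρ τ : ℝ),
        (∀ i j, Measurable fun ω => A ω i j) →
        (∀ i j, MemLp (fun ω => A ω i j) 4 P) →
        iIndepFun (fun (q : Fin m × Fin n) (ω : Ω) => A ω q.1 q.2) P →
        RobustNSP.IsCentral P A 2 →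
        0 < RobustNSP.maxCentralMoment P A 2 →
        0 < κ → 1 / 2 ≤ α →
        (∀ i j, RobustNSP.IsReasonable P
          (fun ω => A ω i j - RobustNSP.meanMatrix P A i j) κ α (Real.log (Real.exp 1 * n))) →
        0 < ρ → ρ < 1 → 0 < τ → 1 ≤ s → s ≤ n →
        max
          (C * (RobustNSP.momentK P A / (RobustNSP.maxCentralMoment P A 2 ^ (5 / 2 : ℝ) * τ) *
            (1 + τ * ρ⁻¹ *
              (Real.exp (2 * α) * κ * √((s : ℝ) * Real.log (Real.exp 1 * n / s))
                + RobustNSP.meanTerm P A s))) ^ 2)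
          (Real.log (Real.exp 1 * n) ^ max (2 * α - 1) 1) ≤ (m : ℝ) →
        1 - Real.exp (-(c * (RobustNSP.maxCentralMoment P A 2 ^ 4
            / RobustNSP.momentK P A ^ 2 * m))) ≤
          P.real {ω | RobustNSP.L2RNSP (A ω) s ρ τ} := by
  -- `C` matches `(300 D)²` with `D = 10⁶`; `1/c = 32 · 100²` converts `p² m / 32` into the stated
  -- exponent.
  refine ⟨(300 * 10 ^ 6) ^ 2, 1 / 320000, by norm_num, by norm_num, ?_⟩
  intro Ω _ P _ m n s A κ α ρ τ hmeas hmem hind hcen hpos hκ hα hr hρ hρ1 hτ hs hsn hm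
  have h : RobustNSP.IsModel P A := ⟨hmeas, hmem, hind, hcen, hpos⟩
  have hF := RobustNSP.meanTerm_nonneg (P := P) (A := A) s
  have hR := h.le_scale_mul (D := 10 ^ 6) hτ hρ (by positivity) (by norm_num)
    ((le_max_left _ _).trans hm)
  have hm' := (le_max_right _ _).trans hm
  have hexp : 1 / 320000 * (RobustNSP.maxCentralMoment P A 2 ^ 4
      / RobustNSP.momentK P A ^ 2 * m) = RobustNSP.smallBall P A ^ 2 * m / 32 := by
    have := h.momentK_pos
    rw [RobustNSP.smallBall]
    field_simp
    ring
  rw [hexp]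
  rcases lt_or_ge n 3 with hn | hn
  · obtain rfl | rfl : n = 1 ∨ n = 2 := by omega
    · have hm0 : 0 < m := by
        have : (0 : ℝ) < m := lt_of_lt_of_le (by simp) hm'
        exact_mod_cast this
      refine h.le_measureReal_of_one hm0 hρ hτ (le_trans ?_ hR)
      refine mul_le_mul_of_nonneg_left (le_add_of_nonneg_right ?_) (by norm_num)
      positivity
    · exact h.le_measureReal_of_two hκ hα hr hρ hρ1 hτ hs hsn hm' hR
  · exact h.le_measureReal_of_three_le hκ hα hr hρ hρ1 hτ hs hsn hn hm' hR
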